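/- Let $|\cdot|$ be a norm on $\mathbb R^d$ and let $\boldsymbol X=\{X_j,\,j\in\mathbb Z\}$ be a strictly stationary $\mathbb R^d$-valued time series, regularly varying with tail index $\alpha>0$: $\lim_{x\to\infty}P(|X_0|>tx)/P(|X_0|>x)=t^{-\alpha}$ for all $t>0$, and for all $i\le j$ the measures $P(x^{-1}(X_i,\dots,X_j)\in\cdot)/P(|X_0|>x)$ converge vaguely, away from the origin, as $x\to\infty$. Let $\boldsymbol Y=\{Y_j,\,j\in\mathbb Z\}$ be its tail process, i.e. for all $i\le j$ the law of $x^{-1}(X_i,\dots,X_j)$ conditionally on $|X_0|>x$ converges weakly to the law of $(Y_i,\dots,Y_j)$ as $x\to\infty$. Let $\Theta_j=Y_j/|Y_0|$. For a sequence $\boldsymbol y=\{y_j,\,j\in\mathbb Z\}$ put $\boldsymbol y^*=\sup_j|y_j|$ and $A_0(\boldsymbol y)=\inf\{j:\sup_{i\le j}|y_i|=\boldsymbol y^*\}$ ($\inf\emptyset=+\infty$). Let $\vartheta=P(A_0(\boldsymbol Y)=0)$, let $\boldsymbol Q$ be a random sequence distributed as $(\boldsymbol Y^*)^{-1}\boldsymbol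 Y$ conditionally on $A_0(\boldsymbol Y)=0$, and let the cluster measure be $$\boldsymbol\nu^*=\int_0^\infty E\big[\delta_{r\boldsymbol\Theta}\mathbf 1\{A_0(\boldsymbol\Theta)=0\}\big]\,\alpha r^{-\alpha-1}\,dr .$$ Let $u_n\to\infty$ be real numbers and $r_n\to\infty$ integers such that the following two conditions hold. * $\mathrm{DH}(r_n,u_n)$: for all $x,y>0$, $\displaystyle\lim_{k\to\infty}\limsup_{n\to\infty}P\Big(\max_{k\le|j|\le r_n}|X_j|>u_nx\,\Big|\,|X_0|>u_ny\Big)=0$. * $\mathrm{ANSJB}(r_n,u_n)$: for all $\eta>0$, $\displaystyle\lim_{\epsilon\to0}\limsup_{n\to\infty}\frac{P\big(\sum_{j=1}^{r_n}|X_j|\mathbf 1\{|X_j|\le\epsilon u_n\}>\eta u_n\big)}{r_nP(|X_0|>u_n)}=0$. Let $K$ be a real functional on $\ell^1=\{\boldsymbol x\in(\mathbb R^d)^{\mathbb Z}:\sum_j|x_j|<\infty\}$ that is shift-invariant, satisfies $K(\boldsymbol 0)=0$ and is Lipschitz: $|K(\boldsymbol x)-K(\boldsymbol y)|\le L_K\sum_j|x_j-y_j|$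 on $\ell^1$. Assume that, for every $s>0$, the functional $\mathbf 1\{K>1\}$ is almost surely continuous on $\ell^1$ with respect to the distribution of $s\boldsymbol Y$, i.e. almost surely, if $s\boldsymbol Y\in\ell^1$, then $\mathbf 1\{K>1\}$ is continuous at $s\boldsymbol Y$ for the $\ell^1$ distance. Then $Y_j\to0$ almost surely as $|j|\to\infty$, $\vartheta>0$, $\boldsymbol Q\in\ell^1$ almost surely, $\boldsymbol\nu^*$ is concentrated on $\ell^1$, and, with $X_{1,r_n}=(X_1,\dots,X_{r_n})$ extended by zeros to a sequence indexed by $\mathbb Z$, $$\lim_{n\to\infty}\frac{P\big(K(X_{1,r_n}/u_n)>1\big)}{r_nP(|X_0|>u_n)}=\boldsymbol\nu^*(\mathbf 1\{K>1\})=\vartheta\int_0^\infty P\big(K(z\boldsymbol Q)>1\big)\,\alpha z^{-\alpha-1}\,dz<\infty .$$ -/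

import Mathlib

open MeasureTheory Filter Topology Set
open scoped ENNReal BoundedContinuousFunction

noncomputable section

namespace ClusterLimit

/-! ### Sequences indexed by `ℤ` with values in a normed space -/

/-- `y* = sup_j |y_j|`, as an extended nonnegative number. -/
def supNorm {E : Type*} [NormedAddCommGroup E] (y : ℤ → E) : ℝ≥0∞ :=
  ⨆ j : ℤ, ‖y j‖ₑ

/-- `y*_{-∞,j} = sup_{i ≤ j} |y_i|`. -/
def supNormUpTo {E : Type*} [NormedAddCommGroup E] (y : ℤ → E) (j : ℤ) : ℝ≥0∞ :=
  ⨆ i : ℤ, ⨆ _ : i ≤ j, ‖y i‖ₑ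

/-- The infargmax functional `A₀(y) = inf {j : y*_{-∞,j} = y*}`, with values in `[-∞, +∞]` and
`inf ∅ = +∞`. -/
def infargmax {E : Type*} [NormedAddCommGroup E] (y : ℤ → E) : EReal :=
  sInf ((fun j : ℤ => ((j : ℝ) : EReal)) '' {j : ℤ | supNormUpTo y j = supNorm y})

/-- The sequence belongs to `ℓ¹`. -/
def MemL1 {E : Type*} [NormedAddCommGroup E] (x : ℤ → E) : Prop :=
  Summable fun j : ℤ => ‖x j‖

/-- Functionals on `ℓ¹` that are shift-invariant, vanish at the zero sequence and are Lipschitz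
with respect to the `ℓ¹` norm. The functional is written as a function on all sequences, but
nothing is required of its values outside `ℓ¹`. -/
structure IsLipschitzClusterFunctional {E : Type*} [NormedAddCommGroup E]
    (K : (ℤ → E) → ℝ) : Prop where
  shift_invariant : ∀ x : ℤ → E, MemL1 x → ∀ k : ℤ, K (fun j => x (j + k)) = K x
  map_zero : K 0 = 0
  lipschitz : ∃ L : ℝ, ∀ x y : ℤ → E, MemL1 x → MemL1 y →
    |K x - K y| ≤ L * ∑' j : ℤ, ‖x j - y j‖

/-- The real functional `H` on `ℓ¹` is continuous at `x` for the `ℓ¹` distance (this says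
nothing when `x` is not in `ℓ¹`, the distance to elements of `ℓ¹` being infinite). -/
def L1ContinuousAt {E : Type*} [NormedAddCommGroup E] (H : (ℤ → E) → ℝ) (x : ℤ → E) : Prop :=
  ∀ ε : ℝ, 0 < ε → ∃ δ : ℝ, 0 < δ ∧ ∀ y : ℤ → E, MemL1 y →
    (∑' j : ℤ, ‖y j - x j‖ₑ) < ENNReal.ofReal δ → |H y - H x| < ε

/-- The functional `1{K > 1}`. -/
def exceed {E : Type*} (K : (ℤ → E) → ℝ) : (ℤ → E) → ℝ :=
  {x : ℤ → E | 1 < K x}.indicator 1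

/-! ### Time series -/

/-- Strict stationarity: the law of the sequence is invariant under all time shifts. -/
def IsStationary {Ω E : Type*} [MeasurableSpace Ω] [MeasurableSpace E]
    (P : Measure Ω) (X : ℤ → Ω → E) : Prop :=
  ∀ k : ℤ, P.map (fun ω (j : ℤ) => X (j + k) ω) = P.map (fun ω (j : ℤ) => X j ω)

/-- Regular variation with tail index `α` of a (stationary) time series. The norm of `X_0` has a
regularly varying tail of index `-α`, and for each window `i ≤ j` the rescaled laws of
`x⁻¹ (X_i, …, X_j)`, divided by `P(|X_0| > x)`, converge vaguely away from the origin, as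
`x → ∞`, to a measure that is finite on complements of neighbourhoods of the origin. -/
structure IsRegularlyVarying {Ω E : Type*} [MeasurableSpace Ω] [NormedAddCommGroup E]
    [NormedSpace ℝ E] [MeasurableSpace E] (P : Measure Ω) (X : ℤ → Ω → E) (α : ℝ) : Prop where
  index_pos : 0 < α
  tail : ∀ t : ℝ, 0 < t →
    Tendsto (fun x : ℝ => P.real {ω | t * x < ‖X 0 ω‖} / P.real {ω | x < ‖X 0 ω‖})
      atTop (𝓝 (t ^ (-α)))
  vague : ∀ i j : ℤ, i ≤ j → ∃ ν : Measure (Finset.Icc i j → E),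
    ν {0} = 0 ∧ (∀ ε : ℝ, 0 < ε → ν {z | ε < ‖z‖} < ∞) ∧
    ∀ f : (Finset.Icc i j → E) →ᵇ ℝ, (∃ ε : ℝ, 0 < ε ∧ ∀ z, ‖z‖ ≤ ε → f z = 0) →
      Tendsto
        (fun x : ℝ => (∫ ω, f (fun l => x⁻¹ • X l ω) ∂P) / P.real {ω | x < ‖X 0 ω‖})
        atTop (𝓝 (∫ z, f z ∂ν))

/-- `Y` (defined on a probability space of its own) is the tail process of `X`: for all `i ≤ j`,
the law of `x⁻¹ (X_i, …, X_j)` conditionally on `|X_0| > x` converges weakly, as `x → ∞`, to the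
law of `(Y_i, …, Y_j)`. -/
def IsTailProcess {Ω Ω' E : Type*} [MeasurableSpace Ω] [MeasurableSpace Ω']
    [NormedAddCommGroup E] [NormedSpace ℝ E]
    (P : Measure Ω) (X : ℤ → Ω → E) (P' : Measure Ω') (Y : ℤ → Ω' → E) : Prop :=
  ∀ i j : ℤ, i ≤ j → ∀ f : (Finset.Icc i j → E) →ᵇ ℝ,
    Tendsto
      (fun x : ℝ => ∫ ω, f (fun l => x⁻¹ • X l ω) ∂(ProbabilityTheory.cond P {ω | x < ‖X 0 ω‖}))
      atTop (𝓝 (∫ ω, f (fun l => Y l ω) ∂P'))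

/-- The anticlustering condition `DH(r_n, u_n)`: for all `x, y > 0`, the limit as `k → ∞` of
`limsup_n P(max_{k ≤ |j| ≤ r_n} |X_j| > u_n x ∣ |X_0| > u_n y)` is zero. -/
def ConditionDH {Ω E : Type*} [MeasurableSpace Ω] [NormedAddCommGroup E]
    (P : Measure Ω) (X : ℤ → Ω → E) (r : ℕ → ℕ) (u : ℕ → ℝ) : Prop :=
  ∀ x y : ℝ, 0 < x → 0 < y →
    Tendsto
      (fun k : ℕ => limsup
        (fun n : ℕ => ProbabilityTheory.cond P {ω | u n * y < ‖X 0 ω‖}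
          {ω | ∃ j : ℤ, (k : ℤ) ≤ |j| ∧ |j| ≤ (r n : ℤ) ∧ u n * x < ‖X j ω‖}) atTop)
      atTop (𝓝 0)

/-- Asymptotic negligibility of small jumps `ANSJB(r_n, u_n)`: for all `η > 0`, the limit as
`ε → 0` of
`limsup_n P(∑_{j=1}^{r_n} |X_j| 1{|X_j| ≤ ε u_n} > η u_n) / (r_n P(|X_0| > u_n))` is zero. -/
def ConditionANSJB {Ω E : Type*} [MeasurableSpace Ω] [NormedAddCommGroup E]
    (P : Measure Ω) (X : ℤ → Ω → E) (r : ℕ → ℕ) (u : ℕ → ℝ) : Prop :=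
  ∀ η : ℝ, 0 < η →
    Tendsto
      (fun ε : ℝ => limsup
        (fun n : ℕ =>
          P {ω | η * u n < ∑ j ∈ Finset.Icc (1 : ℤ) (r n),
            {a : E | ‖a‖ ≤ ε * u n}.indicator (fun a => ‖a‖) (X j ω)}
            / ((r n : ℝ≥0∞) * P {ω | u n < ‖X 0 ω‖})) atTop)
      (𝓝[>] 0) (𝓝 0)

/-- The rescaled block `X_{1,r} / u`, extended by zeros to a sequence indexed by `ℤ`. -/
def block {Ω E : Type*} [NormedAddCommGroup E] [NormedSpace ℝ E]
    (X : ℤ → Ω → E) (r : ℕ) (u : ℝ) (ω : Ω) : ℤ → E :=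
  fun j => if 1 ≤ j ∧ j ≤ (r : ℤ) then u⁻¹ • X j ω else 0

/-! ### Cluster measure -/

/-- The candidate extremal index `ϑ = P(A₀(Y) = 0)`. -/
def candidateIndex {Ω' E : Type*} [MeasurableSpace Ω'] [NormedAddCommGroup E]
    (P' : Measure Ω') (Y : ℤ → Ω' → E) : ℝ≥0∞ :=
  P' {ω | infargmax (fun j => Y j ω) = 0}

/-- The spectral tail process `Θ_j = Y_j / |Y_0|`. -/
def spectral {Ω' E : Type*} [NormedAddCommGroup E] [NormedSpace ℝ E]
    (Y : ℤ → Ω' → E) (ω : Ω') : ℤ → E :=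
  fun j => ‖Y 0 ω‖⁻¹ • Y j ω

/-- The law of the sequence `Q`: the law of `(Y*)⁻¹ Y` conditionally on `A₀(Y) = 0`. -/
def lawQ {Ω' E : Type*} [MeasurableSpace Ω'] [NormedAddCommGroup E] [NormedSpace ℝ E]
    [MeasurableSpace E] (P' : Measure Ω') (Y : ℤ → Ω' → E) : Measure (ℤ → E) :=
  (ProbabilityTheory.cond P' {ω | infargmax (fun j => Y j ω) = 0}).map
    fun ω (j : ℤ) => (supNorm fun i => Y i ω).toReal⁻¹ • Y j ω

/-- The measure `α z^{-α-1} dz` on `(0, ∞)`. -/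
def radial (α : ℝ) : Measure ℝ :=
  (volume.restrict (Ioi 0)).withDensity fun z => ENNReal.ofReal (α * z ^ (-α - 1))

/-- The cluster measure `ν* = ∫_0^∞ E[δ_{rΘ} 1{A₀(Θ) = 0}] α r^{-α-1} dr`. -/
def clusterMeasure {Ω' E : Type*} [MeasurableSpace Ω'] [NormedAddCommGroup E]
    [NormedSpace ℝ E] [MeasurableSpace E] (P' : Measure Ω') (Y : ℤ → Ω' → E) (α : ℝ) :
    Measure (ℤ → E) :=
  ((radial α).prod (P'.restrict {ω | infargmax (spectral Y ω) = 0})).map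
    fun p => p.1 • spectral Y p.2

end ClusterLimit

end

set_option linter.unusedSectionVars false

noncomputable section

namespace ClusterLimit

/-! Fix `ε > 0` and cut a block at its first index `j` with `|X_j| > ε u_n`. These events are
disjoint in `j`. By stationarity, each of them looks like an exceedance at time `0` with no earlier
exceedance in the block. After division by `r_n P(|X_0| > u_n)`, regular variation supplies the
factor `ε^{-α}`, and the rescaled window around `j` converges to the tail process on the event that
`|Y_i| ≤ 1` for all `i < 0`. Anticlustering makes everything outside the window at most `δ u_n`.
`ANSJB` then makes the sum of those terms negligible, and the Lipschitz property transfers this to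
shift-invariant functionals (`block_inequality`, `block_bound`, `le_liminf_block`).

This argument gives lower bounds only, for events `Φ > 0` with `Φ` Lipschitz. It is applied to `Φ =
K - 1` and to `Φ` = the capped `ℓ¹` distance to `{K > 1}`. The two events are disjoint, and almost
sure continuity of `1{K > 1}` means that `ε Y` belongs to one of them. The sum of the two lower
bounds therefore equals the upper bound for the probability that the block has an exceedance
(`limsup_blockExceed_le`), so both bounds are limits.

Two properties of `Y` identify the limit. The time change formula, inherited from stationarity,
shows that anchoring at the first exceedance or at the first maximum gives the same probability to
shift-invariant events (`IsAnchor.measure_eq`). The polar decomposition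
(`IsTailProcess.prod_radial_spectral`) says that `|Y_0|` is Pareto and independent of `Θ`, so
`ε^{-α} P(ε Y ∈ T, first maximum at 0)` is the mass that `ν*` gives to `T` at radii `r > ε`. Finally
`ε → 0`: a block with `K > 1` and no exceedance of `ε u_n` has a large sum of small terms, which
`ANSJB` excludes asymptotically.

Summability of `Y` comes from the same block bound: a non-summable path tending to zero would have
an infinite sum of arbitrarily small terms, contradicting `ANSJB`. -/

/-! ### Bounded continuous cylinder functions and determination of measures -/

/-- Bounded continuous functions of finitely many coordinates. -/
structure IsCylinderBC {E : Type*} [TopologicalSpace E] (F : (ℤ → E) → ℝ) : Prop where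
  cont : Continuous F
  bdd : ∃ C, ∀ y, |F y| ≤ C
  dep : ∃ S : Finset ℤ, ∀ x y : ℤ → E, (∀ i ∈ S, x i = y i) → F x = F y

/-- The cutoff `min 1 (k (s - 1)₊)`, which increases to the indicator of `(1, ∞)`. -/
def cutoff (k : ℕ) (s : ℝ) : ℝ := min 1 (k * max 0 (s - 1))

lemma continuous_cutoff (k : ℕ) : Continuous (cutoff k) := by
  unfold cutoff; fun_prop

lemma cutoff_nonneg (k : ℕ) (s : ℝ) : 0 ≤ cutoff k s := by
  unfold cutoff; positivity

lemma abs_cutoff_le (k : ℕ) (s : ℝ) : |cutoff k s| ≤ 1 := by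
  rw [abs_of_nonneg (cutoff_nonneg k s)]; exact min_le_left _ _

lemma cutoff_of_le (k : ℕ) {s : ℝ} (h : s ≤ 1) : cutoff k s = 0 := by
  unfold cutoff; rw [max_eq_left (by linarith)]; simp

lemma tendsto_cutoff {s : ℝ} (h : 1 < s) : Tendsto (fun k => cutoff k s) atTop (𝓝 1) := by
  have h1 : Tendsto (fun k : ℕ => (k : ℝ) * max 0 (s - 1)) atTop atTop :=
    tendsto_natCast_atTop_atTop.atTop_mul_const (lt_max_of_lt_right (by linarith))
  refine tendsto_const_nhds.congr' ?_
  filter_upwards [h1.eventually_ge_atTop 1] with k hk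
  simp [cutoff, hk]

variable {E : Type*} [NormedAddCommGroup E] [NormedSpace ℝ E]
  [MeasurableSpace E] [BorelSpace E] [SecondCountableTopology E]

/-- Finite measures on the sequence space that agree on bounded continuous cylinder functions
vanishing when a coordinate from `J` is in the unit ball, agree where these coordinates are
outside the unit ball. -/
lemma restrict_eq_of_integral_eq (μ ν : Measure (ℤ → E)) [IsFiniteMeasure μ] [IsFiniteMeasure ν]
    (J : Finset ℤ)
    (h : ∀ F : (ℤ → E) → ℝ, IsCylinderBC F → (∀ y, (∃ j ∈ J, ‖y j‖ ≤ 1) → F y = 0) →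
      ∫ y, F y ∂μ = ∫ y, F y ∂ν) :
    μ.restrict {y | ∀ j ∈ J, 1 < ‖y j‖} = ν.restrict {y | ∀ j ∈ J, 1 < ‖y j‖} := by
  set B : Set (ℤ → E) := {y | ∀ j ∈ J, 1 < ‖y j‖} with hB
  have hBm : MeasurableSet B := by
    have : B = ⋂ j ∈ J, {y | 1 < ‖y j‖} := by ext; simp [hB]
    rw [this]
    exact Finset.measurableSet_biInter _ fun j _ =>
      measurableSet_lt measurable_const (measurable_pi_apply j).norm
  -- Multiplication by cutoffs makes any function of a window admissible in `h`; dominated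
  -- convergence then replaces the cutoffs by the indicator of `B`.
  have key : ∀ I : Finset ℤ, ∀ f : (I → E) →ᵇ ℝ,
      ∫ y in B, f (I.restrict y) ∂μ = ∫ y in B, f (I.restrict y) ∂ν := by
    intro I f
    set G : ℕ → (ℤ → E) → ℝ := fun k y => f (I.restrict y) * ∏ j ∈ J, cutoff k ‖y j‖ with hG
    have hGc : ∀ k, Continuous (G k) := by
      intro k
      refine (f.continuous.comp (Pi.continuous_domRestrict _)).mul ?_
      exact continuous_finsetProd _ fun j _ =>
        (continuous_cutoff k).comp (continuous_apply j).norm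
    have hGb : ∀ k y, |G k y| ≤ ‖f‖ := by
      intro k y
      rw [hG]
      simp only [abs_mul, Finset.abs_prod]
      calc _ ≤ ‖f‖ * 1 := by
            gcongr
            · exact f.norm_coe_le_norm _
            · exact Finset.prod_le_one (fun _ _ => abs_nonneg _) fun _ _ => abs_cutoff_le _ _
        _ = _ := mul_one _
    have hG0 : ∀ k y, (∃ j ∈ J, ‖y j‖ ≤ 1) → G k y = 0 := by
      rintro k y ⟨j, hj, hy⟩
      simp only [hG]
      rw [Finset.prod_eq_zero hj (cutoff_of_le k hy), mul_zero]
    have hGd : ∀ k, ∃ S : Finset ℤ, ∀ x y : ℤ → E, (∀ i ∈ S, x i = y i) → G k x = G k y := by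
      intro k
      refine ⟨I ∪ J, fun x y hxy => ?_⟩
      simp only [hG]
      congr 1
      · congr 1; ext i; exact hxy i (Finset.mem_union_left _ i.2)
      · exact Finset.prod_congr rfl fun j hj => by rw [hxy j (Finset.mem_union_right _ hj)]
    have hlim : ∀ y, Tendsto (fun k => G k y) atTop (𝓝 (B.indicator (fun y => f (I.restrict y)) y)) := by
      intro y
      by_cases hy : y ∈ B
      · rw [indicator_of_mem hy]
        have : Tendsto (fun k => ∏ j ∈ J, cutoff k ‖y j‖) atTop (𝓝 (∏ j ∈ J, (1 : ℝ))) :=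
          tendsto_finsetProd _ fun j hj => tendsto_cutoff (hy j hj)
        simpa using this.const_mul (f (I.restrict y))
      · rw [indicator_of_notMem hy]
        have hex : ∃ j ∈ J, ‖y j‖ ≤ 1 := by simpa [hB] using hy
        exact tendsto_const_nhds.congr fun k => (hG0 k y hex).symm
    have hI : ∀ (ρ : Measure (ℤ → E)) [IsFiniteMeasure ρ],
        Tendsto (fun k => ∫ y, G k y ∂ρ) atTop (𝓝 (∫ y in B, f (I.restrict y) ∂ρ)) := by
      intro ρ _
      rw [← integral_indicator hBm]
      exact tendsto_integral_of_dominated_convergence (fun _ => ‖f‖)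
        (fun k => (hGc k).measurable.aestronglyMeasurable) (integrable_const _)
        (fun k => Eventually.of_forall fun y => hGb k y) (Eventually.of_forall hlim)
    refine tendsto_nhds_unique (hI μ) ((hI ν).congr fun k => ?_)
    exact (h (G k) ⟨hGc k, ⟨_, hGb k⟩, hGd k⟩ (hG0 k)).symm
  have hproj : ∀ I : Finset ℤ, (ν.restrict B).map I.restrict = (μ.restrict B).map I.restrict := by
    intro I
    refine ext_of_forall_integral_eq_of_IsFiniteMeasure fun f => ?_
    rw [integral_map (Finset.measurable_restrict I).aemeasurable
        f.continuous.measurable.aestronglyMeasurable,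
      integral_map (Finset.measurable_restrict I).aemeasurable
        f.continuous.measurable.aestronglyMeasurable]
    exact (key I f).symm
  exact IsProjectiveLimit.unique (P := fun I => (μ.restrict B).map I.restrict)
    (fun I => rfl) (fun I => hproj I)

/-! ### Tails and weak limits -/

variable {Ω Ω' : Type*} [MeasurableSpace Ω] [MeasurableSpace Ω']
  {P : Measure Ω} [IsProbabilityMeasure P] {X : ℤ → Ω → E} {α : ℝ}
  {P' : Measure Ω'} [IsProbabilityMeasure P'] {Y : ℤ → Ω' → E}

/-- A tail that vanishes at one level vanishes at all higher ones. The ratios at `t = 1` would then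
be `0 / 0 = 0`, whereas they tend to `1`. -/
lemma IsRegularlyVarying.tail_pos (hRV : IsRegularlyVarying P X α) (x : ℝ) :
    0 < P {ω | x < ‖X 0 ω‖} := by
  rw [pos_iff_ne_zero]
  intro h0
  have h1 := hRV.tail 1 one_pos
  have h2 : Tendsto (fun x : ℝ => P.real {ω | 1 * x < ‖X 0 ω‖} / P.real {ω | x < ‖X 0 ω‖})
      atTop (𝓝 0) := by
    refine tendsto_const_nhds.congr' ?_
    filter_upwards [eventually_ge_atTop x] with z hz
    have : P {ω | z < ‖X 0 ω‖} = 0 :=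
      measure_mono_null (fun ω (hω : z < _) => lt_of_le_of_lt hz hω) h0
    simp [measureReal_def, this]
  have := tendsto_nhds_unique h1 h2
  simp at this

lemma IsRegularlyVarying.tail_real_pos (hRV : IsRegularlyVarying P X α) (x : ℝ) :
    0 < P.real {ω | x < ‖X 0 ω‖} :=
  ENNReal.toReal_pos (hRV.tail_pos x).ne' (measure_ne_top _ _)

lemma IsRegularlyVarying.tail_ennreal (hRV : IsRegularlyVarying P X α) {t : ℝ} (ht : 0 < t) :
    Tendsto (fun x : ℝ => P {ω | t * x < ‖X 0 ω‖} / P {ω | x < ‖X 0 ω‖})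
      atTop (𝓝 (ENNReal.ofReal (t ^ (-α)))) := by
  refine (ENNReal.tendsto_ofReal (hRV.tail t ht)).congr fun x => ?_
  rw [ENNReal.ofReal_div_of_pos (hRV.tail_real_pos x), ofReal_measureReal, ofReal_measureReal]

/-- Extension of a finite window by zeros. -/
def extendZero {E : Type*} [Zero E] (I : Finset ℤ) (z : I → E) : ℤ → E :=
  fun i => if h : i ∈ I then z ⟨i, h⟩ else 0

lemma continuous_extendZero (I : Finset ℤ) : Continuous (extendZero (E := E) I) := by
  refine continuous_pi fun i => ?_
  by_cases h : i ∈ I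
  · simpa [extendZero, h] using continuous_apply _
  · simpa [extendZero, h] using continuous_const

lemma exists_Icc_superset (S : Finset ℤ) : ∃ m : ℕ, S ⊆ Finset.Icc (-(m : ℤ)) m := by
  refine ⟨S.sup Int.natAbs, fun i hi => ?_⟩
  have : i.natAbs ≤ S.sup Int.natAbs := Finset.le_sup (f := Int.natAbs) hi
  simp only [Finset.mem_Icc]; omega

lemma IsTailProcess.tendsto_integral (hY : IsTailProcess P X P' Y) {F : (ℤ → E) → ℝ}
    (hF : IsCylinderBC F) :
    Tendsto (fun x : ℝ => ∫ ω, F (fun j => x⁻¹ • X j ω)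
      ∂(ProbabilityTheory.cond P {ω | x < ‖X 0 ω‖})) atTop (𝓝 (∫ ω, F (fun j => Y j ω) ∂P')) := by
  obtain ⟨S, hS⟩ := hF.dep
  obtain ⟨C, hC⟩ := hF.bdd
  obtain ⟨m, hm⟩ := exists_Icc_superset S
  set I := Finset.Icc (-(m : ℤ)) m
  have hd : ∀ y : ℤ → E, F (extendZero I (fun l => y l)) = F y := fun y =>
    hS _ _ fun i hi => by simp [extendZero, hm hi]
  let f : (I → E) →ᵇ ℝ := BoundedContinuousFunction.ofNormedAddCommGroup
    (fun z => F (extendZero I z)) (hF.cont.comp (continuous_extendZero I)) C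
    (fun z => hC _)
  have := hY (-(m : ℤ)) m (by omega) f
  have h1 : ∀ y : ℤ → E, f (fun l => y l) = F y := fun y => hd y
  refine (Tendsto.congr (fun x => ?_) this).trans_eq ?_
  · exact integral_congr_ae (Eventually.of_forall fun ω => h1 (fun j => x⁻¹ • X j ω))
  · exact congrArg _ (integral_congr_ae (Eventually.of_forall fun ω => h1 (fun j => Y j ω)))

/-- For such `F` the conditioning event may be dropped from the integral. The resulting
unconditional form is the one to which stationarity and changes of level apply. -/
lemma IsTailProcess.tendsto_integral_div (hXm : ∀ j, Measurable (X j))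
    (hY : IsTailProcess P X P' Y) {F : (ℤ → E) → ℝ}
    (hF : IsCylinderBC F) (h0 : ∀ y, ‖y 0‖ ≤ 1 → F y = 0) :
    Tendsto (fun x : ℝ => (∫ ω, F (fun j => x⁻¹ • X j ω) ∂P) / P.real {ω | x < ‖X 0 ω‖})
      atTop (𝓝 (∫ ω, F (fun j => Y j ω) ∂P')) := by
  refine (hY.tendsto_integral hF).congr' ?_
  filter_upwards [eventually_gt_atTop 0] with x hx
  have hm : MeasurableSet {ω | x < ‖X 0 ω‖} := measurableSet_lt measurable_const (hXm 0).norm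
  rw [ProbabilityTheory.cond, integral_smul_measure, ENNReal.toReal_inv, ← measureReal_def,
    smul_eq_mul, ← integral_indicator hm, div_eq_inv_mul]
  congr 2
  ext ω
  by_cases hω : x < ‖X 0 ω‖
  · rw [indicator_of_mem (by exact hω)]
  · rw [indicator_of_notMem (by exact hω), h0]
    rw [norm_smul, norm_inv, Real.norm_of_nonneg hx.le, inv_mul_le_iff₀ hx]
    simpa using hω

/-- Portmanteau for open cylinders. -/
lemma IsTailProcess.le_liminf_open (hXm : ∀ j, Measurable (X j)) (hYm : ∀ j, Measurable (Y j))
    (hRV : IsRegularlyVarying P X α)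
    (hY : IsTailProcess P X P' Y) {W : Set (ℤ → E)} (hW : IsOpen W) {S : Finset ℤ}
    (hS : ∀ x y : ℤ → E, (∀ i ∈ S, x i = y i) → x ∈ W → y ∈ W) :
    P' {ω | (fun j => Y j ω) ∈ W} ≤ liminf (fun x : ℝ =>
      ProbabilityTheory.cond P {ω | x < ‖X 0 ω‖} {ω | (fun j => x⁻¹ • X j ω) ∈ W}) atTop := by
  obtain ⟨m, hm⟩ := exists_Icc_superset S
  set I := Finset.Icc (-(m : ℤ)) m
  have hd : ∀ y : ℤ → E, extendZero I (fun l => y l) ∈ W ↔ y ∈ W := fun y =>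
    ⟨hS _ _ fun i hi => by simp [extendZero, hm hi], hS _ _ fun i hi => by simp [extendZero, hm hi]⟩
  have hW' : IsOpen (extendZero I ⁻¹' W) := hW.preimage (continuous_extendZero I)
  have hcp : ∀ x : ℝ, IsProbabilityMeasure (ProbabilityTheory.cond P {ω | x < ‖X 0 ω‖}) := fun x =>
    ProbabilityTheory.cond_isProbabilityMeasure (hRV.tail_pos x).ne'
  have hmX : ∀ x : ℝ, Measurable (fun ω (l : I) => x⁻¹ • X l ω) := fun x =>
    measurable_pi_lambda _ fun l => (hXm l).const_smul _
  have hmY : Measurable (fun ω (l : I) => Y l ω) := measurable_pi_lambda _ fun l => hYm l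
  let μ : ℝ → ProbabilityMeasure (I → E) := fun x =>
    ⟨(ProbabilityTheory.cond P {ω | x < ‖X 0 ω‖}).map (fun ω (l : I) => x⁻¹ • X l ω),
      Measure.isProbabilityMeasure_map (hmX x).aemeasurable⟩
  let ν : ProbabilityMeasure (I → E) :=
    ⟨P'.map (fun ω (l : I) => Y l ω), Measure.isProbabilityMeasure_map hmY.aemeasurable⟩
  have hlim : Tendsto μ atTop (𝓝 ν) := by
    rw [ProbabilityMeasure.tendsto_iff_forall_integral_tendsto]
    intro f
    have := hY (-(m : ℤ)) m (by omega) f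
    refine (this.congr fun x => ?_).trans_eq ?_
    · exact (integral_map (hmX x).aemeasurable f.continuous.measurable.aestronglyMeasurable).symm
    · exact congrArg _
        (integral_map hmY.aemeasurable f.continuous.measurable.aestronglyMeasurable).symm
  have := ProbabilityMeasure.le_liminf_measure_open_of_tendsto hlim hW'
  have hν : (ν : Measure (I → E)) (extendZero I ⁻¹' W) =
    P' ((fun ω (l : I) => Y l ω) ⁻¹' (extendZero I ⁻¹' W)) := Measure.map_apply hmY hW'.measurableSet
  have hμ : ∀ x, (μ x : Measure (I → E)) (extendZero I ⁻¹' W) =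
    ProbabilityTheory.cond P {ω | x < ‖X 0 ω‖}
      ((fun ω (l : I) => x⁻¹ • X l ω) ⁻¹' (extendZero I ⁻¹' W)) :=
    fun x => Measure.map_apply (hmX x) hW'.measurableSet
  simp only [hν, hμ] at this
  have e1 : {ω | (fun j => Y j ω) ∈ W} =
      (fun ω (l : I) => Y l ω) ⁻¹' (extendZero I ⁻¹' W) := by
    ext ω; exact (hd fun j => Y j ω).symm
  have e2 : ∀ x : ℝ, {ω | (fun j => x⁻¹ • X j ω) ∈ W} =
      (fun ω (l : I) => x⁻¹ • X l ω) ⁻¹' (extendZero I ⁻¹' W) := by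
    intro x; ext ω; exact (hd fun j => x⁻¹ • X j ω).symm
  simpa only [e1, e2] using this

/-- Portmanteau for closed cylinders. -/
lemma IsTailProcess.limsup_closed_le (hXm : ∀ j, Measurable (X j)) (hYm : ∀ j, Measurable (Y j))
    (hRV : IsRegularlyVarying P X α)
    (hY : IsTailProcess P X P' Y) {W : Set (ℤ → E)} (hW : IsClosed W) {S : Finset ℤ}
    (hS : ∀ x y : ℤ → E, (∀ i ∈ S, x i = y i) → x ∈ W → y ∈ W) :
    limsup (fun x : ℝ => ProbabilityTheory.cond P {ω | x < ‖X 0 ω‖}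
      {ω | (fun j => x⁻¹ • X j ω) ∈ W}) atTop ≤ P' {ω | (fun j => Y j ω) ∈ W} := by
  have h := hY.le_liminf_open hXm hYm hRV hW.isOpen_compl (S := S)
    (fun x y hxy hx hy => hx (hS y x (fun i hi => (hxy i hi).symm) hy))
  have hmX : ∀ x : ℝ, Measurable (fun ω (l : ℤ) => x⁻¹ • X l ω) := fun x =>
    measurable_pi_lambda _ fun l => (hXm l).const_smul _
  have hmY : Measurable (fun ω (l : ℤ) => Y l ω) := measurable_pi_lambda _ fun l => hYm l
  have hcp : ∀ x : ℝ, IsProbabilityMeasure (ProbabilityTheory.cond P {ω | x < ‖X 0 ω‖}) := fun x =>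
    ProbabilityTheory.cond_isProbabilityMeasure (hRV.tail_pos x).ne'
  have e1 : P' {ω | (fun j => Y j ω) ∈ Wᶜ} = 1 - P' {ω | (fun j => Y j ω) ∈ W} :=
    prob_compl_eq_one_sub (hmY hW.measurableSet)
  have e2 : ∀ x : ℝ, ProbabilityTheory.cond P {ω | x < ‖X 0 ω‖}
      {ω | (fun j => x⁻¹ • X j ω) ∈ Wᶜ} = 1 - ProbabilityTheory.cond P {ω | x < ‖X 0 ω‖}
      {ω | (fun j => x⁻¹ • X j ω) ∈ W} := fun x =>
    prob_compl_eq_one_sub (hmX x hW.measurableSet)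
  simp_rw [e1, e2] at h
  rw [ENNReal.liminf_const_sub _ _ ENNReal.one_ne_top] at h
  have h1 : limsup (fun x : ℝ => ProbabilityTheory.cond P {ω | x < ‖X 0 ω‖}
      {ω | (fun j => x⁻¹ • X j ω) ∈ W}) atTop ≤ 1 :=
    limsup_le_of_le (by isBoundedDefault) (Eventually.of_forall fun x => prob_le_one)
  exact (ENNReal.sub_le_sub_iff_left h1 ENNReal.one_ne_top).1 h

/-- Weak convergence alone only keeps `1 ≤ ‖Y 0‖`. The closed sets `t ≤ ‖y 0‖` with `t > 1` have
limiting mass at least `t ^ (-α)`, which tends to `1` as `t ↓ 1`. -/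
lemma IsTailProcess.ae_one_lt (hXm : ∀ j, Measurable (X j)) (hYm : ∀ j, Measurable (Y j))
    (hRV : IsRegularlyVarying P X α) (hY : IsTailProcess P X P' Y) :
    ∀ᵐ ω ∂P', 1 < ‖Y 0 ω‖ := by
  have hm : MeasurableSet {ω | 1 < ‖Y 0 ω‖} := measurableSet_lt measurable_const (hYm 0).norm
  rw [ae_iff_prob_eq_one (by exact measurableSet_setOfPred.1 hm)]
  refine le_antisymm prob_le_one ?_
  have key : ∀ t : ℝ, 1 < t → ENNReal.ofReal (t ^ (-α)) ≤ P' {ω | 1 < ‖Y 0 ω‖} := by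
    intro t ht
    have hW : IsClosed {y : ℤ → E | t ≤ ‖y 0‖} :=
      isClosed_le continuous_const (continuous_apply 0).norm
    have h1 := hY.limsup_closed_le hXm hYm hRV hW (S := {0})
      (fun x y hxy hx => by
        have := hxy 0 (by simp)
        simpa [← this] using hx)
    refine le_trans ?_ (h1.trans (measure_mono fun ω (hω : t ≤ ‖Y 0 ω‖) => lt_of_lt_of_le ht hω))
    rw [← (hRV.tail_ennreal (zero_lt_one.trans ht)).limsup_eq]
    refine limsup_le_limsup ?_ (by isBoundedDefault) (by isBoundedDefault)
    filter_upwards [eventually_gt_atTop 0] with x hx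
    have hmx : MeasurableSet {ω | x < ‖X 0 ω‖} := measurableSet_lt measurable_const (hXm 0).norm
    rw [ProbabilityTheory.cond_apply hmx, ENNReal.div_eq_inv_mul]
    gcongr
    intro ω hω
    have hω' : t * x < ‖X 0 ω‖ := hω
    refine ⟨lt_trans (by nlinarith) hω', ?_⟩
    show t ≤ ‖x⁻¹ • X 0 ω‖
    rw [norm_smul, norm_inv, Real.norm_of_nonneg hx.le, le_inv_mul_iff₀ hx]
    linarith
  have hlim : Tendsto (fun t : ℝ => ENNReal.ofReal (t ^ (-α))) (𝓝[>] 1) (𝓝 1) := by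
    have : ContinuousAt (fun t : ℝ => t ^ (-α)) 1 := by
      exact Real.continuousAt_rpow_const _ _ (Or.inl one_ne_zero)
    have h2 := ENNReal.tendsto_ofReal (this.tendsto.mono_left (nhdsWithin_le_nhds (s := Ioi 1)))
    simpa using h2
  exact le_of_tendsto hlim (eventually_nhdsWithin_of_forall fun t ht => key t ht)

/-! ### Stationarity, time change and scaling of the tail process. -/

lemma IsStationary.measure_eq (hXm : ∀ j, Measurable (X j)) (hX : IsStationary P X) (k : ℤ)
    {A : Set (ℤ → E)} (hA : MeasurableSet A) :
    P {ω | (fun j => X (j + k) ω) ∈ A} = P {ω | (fun j => X j ω) ∈ A} := by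
  have h := congrArg (fun μ : Measure (ℤ → E) => μ A) (hX k)
  beta_reduce at h
  rwa [Measure.map_apply (measurable_pi_lambda _ fun l => hXm _) hA,
    Measure.map_apply (measurable_pi_lambda _ fun l => hXm _) hA] at h

lemma IsStationary.integral_eq (hXm : ∀ j, Measurable (X j)) (hX : IsStationary P X) (k : ℤ)
    {F : (ℤ → E) → ℝ} (hF : Measurable F) :
    ∫ ω, F (fun j => X (j + k) ω) ∂P = ∫ ω, F (fun j => X j ω) ∂P := by
  have h := congrArg (fun μ => ∫ y, F y ∂μ) (hX k)
  beta_reduce at h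
  rwa [integral_map (measurable_pi_lambda _ fun l => hXm _).aemeasurable
      hF.aestronglyMeasurable, integral_map (measurable_pi_lambda _ fun l => hXm _).aemeasurable
      hF.aestronglyMeasurable] at h

lemma IsCylinderBC.shift {F : (ℤ → E) → ℝ} (hF : IsCylinderBC F) (j : ℤ) :
    IsCylinderBC (fun y => F (fun i => y (i - j))) := by
  obtain ⟨C, hC⟩ := hF.bdd
  obtain ⟨S, hS⟩ := hF.dep
  refine ⟨hF.cont.comp (by fun_prop), ⟨C, fun y => hC _⟩, S.image (· - j), fun x y h => ?_⟩
  exact hS _ _ fun i hi => h _ (Finset.mem_image_of_mem _ hi)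

lemma IsCylinderBC.smul {F : (ℤ → E) → ℝ} (hF : IsCylinderBC F) (c : ℝ) :
    IsCylinderBC (fun y => F (fun i => c • y i)) := by
  obtain ⟨C, hC⟩ := hF.bdd
  obtain ⟨S, hS⟩ := hF.dep
  refine ⟨hF.cont.comp (by fun_prop), ⟨C, fun y => hC _⟩, S, fun x y h => ?_⟩
  exact hS _ _ fun i hi => by rw [h i hi]

/-- Both `F` and its shift vanish when coordinate `0` is in the unit ball, so both integrals are
limits of unconditional expectations. Stationarity makes these equal before the limit. -/
lemma IsTailProcess.integral_shift (hXm : ∀ j, Measurable (X j))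
    (hX : IsStationary P X)
    (hY : IsTailProcess P X P' Y) (j : ℤ) {F : (ℤ → E) → ℝ} (hF : IsCylinderBC F)
    (h0 : ∀ y, ‖y 0‖ ≤ 1 → F y = 0) (hj : ∀ y, ‖y j‖ ≤ 1 → F y = 0) :
    ∫ ω, F (fun i => Y i ω) ∂P' = ∫ ω, F (fun i => Y (i - j) ω) ∂P' := by
  have h1 := hY.tendsto_integral_div hXm hF h0
  have h2 := hY.tendsto_integral_div hXm (hF.shift j) (fun y hy => hj _ (by simpa using hy))
  refine tendsto_nhds_unique h1 (h2.congr fun x => ?_)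
  congr 1
  exact hX.integral_eq hXm (-j) (hF.smul x⁻¹).cont.measurable

/-- The time change formula for the tail process. -/
lemma IsTailProcess.time_change (hXm : ∀ j, Measurable (X j)) (hYm : ∀ j, Measurable (Y j))
    (hX : IsStationary P X) (hRV : IsRegularlyVarying P X α) (hY : IsTailProcess P X P' Y) (j : ℤ)
    {A : Set (ℤ → E)} (hA : MeasurableSet A) :
    P' {ω | (fun i => Y i ω) ∈ A ∧ 1 < ‖Y j ω‖} =
      P' {ω | (fun i => Y (i - j) ω) ∈ A ∧ 1 < ‖Y (-j) ω‖} := by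
  have hm1 : Measurable (fun ω i => Y i ω) := measurable_pi_lambda _ fun l => hYm l
  have hm2 : Measurable (fun ω i => Y (i - j) ω) := measurable_pi_lambda _ fun l => hYm _
  have h := restrict_eq_of_integral_eq (P'.map (fun ω i => Y i ω))
    (P'.map (fun ω i => Y (i - j) ω)) {0, j} (fun F hF h0 => by
      rw [integral_map hm1.aemeasurable hF.cont.measurable.aestronglyMeasurable,
        integral_map hm2.aemeasurable hF.cont.measurable.aestronglyMeasurable]
      exact hY.integral_shift hXm hX j hF (fun y hy => h0 y ⟨0, by simp, hy⟩)
        (fun y hy => h0 y ⟨j, by simp, hy⟩))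
  have h' := congrArg (fun μ => μ A) h
  simp only [Finset.mem_insert, Finset.mem_singleton, forall_eq_or_imp, forall_eq] at h'
  have hB : MeasurableSet {y : ℤ → E | 1 < ‖y 0‖ ∧ 1 < ‖y j‖} :=
    (measurableSet_lt measurable_const (measurable_pi_apply 0).norm).inter
      (measurableSet_lt measurable_const (measurable_pi_apply j).norm)
  rw [Measure.restrict_apply hA, Measure.restrict_apply hA, Measure.map_apply hm1 (hA.inter hB),
    Measure.map_apply hm2 (hA.inter hB)] at h'
  have hae := hY.ae_one_lt hXm hYm hRV
  calc _ = P' ((fun ω i => Y i ω) ⁻¹' (A ∩ {y | 1 < ‖y 0‖ ∧ 1 < ‖y j‖})) := by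
        refine measure_congr ?_
        filter_upwards [hae] with ω hω
        simp only [eq_iff_iff]
        exact ⟨fun h => ⟨h.1, hω, h.2⟩, fun h => ⟨h.1, h.2.2⟩⟩
    _ = _ := h'
    _ = _ := by
        refine measure_congr ?_
        filter_upwards [hae] with ω hω
        simp only [eq_iff_iff]
        exact ⟨fun h => ⟨h.1, by simpa using h.2.1⟩,
          fun h => ⟨h.1, by simpa using h.2, by simpa using hω⟩⟩

/-- One expectation is normalised at level `x` and at level `t * x`; the ratio of the two tails
supplies the power of `t`. The condition `1 ≤ t` ensures that the rescaled function still vanishes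
for `‖y 0‖ ≤ 1`. -/
lemma IsTailProcess.integral_scale (hXm : ∀ j, Measurable (X j))
    (hRV : IsRegularlyVarying P X α)
    (hY : IsTailProcess P X P' Y) {t : ℝ} (ht : 1 ≤ t) {F : (ℤ → E) → ℝ} (hF : IsCylinderBC F)
    (h0 : ∀ y, ‖y 0‖ ≤ 1 → F y = 0) :
    ∫ ω, F (fun i => t⁻¹ • Y i ω) ∂P' = t ^ (-α) * ∫ ω, F (fun i => Y i ω) ∂P' := by
  have ht0 : 0 < t := by linarith
  have h1 := hY.tendsto_integral_div hXm (hF.smul t⁻¹) (fun y hy => h0 _ (by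
    rw [norm_smul, norm_inv, Real.norm_of_nonneg ht0.le, inv_mul_le_iff₀ ht0]; linarith))
  have h2 := (hRV.tail t ht0).mul
    ((hY.tendsto_integral_div hXm hF h0).comp (tendsto_id.const_mul_atTop ht0))
  refine tendsto_nhds_unique h1 (h2.congr fun x => ?_)
  have hp := (hRV.tail_real_pos (t * x)).ne'
  simp only [Function.comp, id]
  simp only [mul_inv, mul_smul]
  field_simp

lemma IsTailProcess.measure_scale (hXm : ∀ j, Measurable (X j)) (hYm : ∀ j, Measurable (Y j))
    (hRV : IsRegularlyVarying P X α) (hY : IsTailProcess P X P' Y) {t : ℝ} (ht : 1 ≤ t)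
    {A : Set (ℤ → E)} (hA : MeasurableSet A) :
    P' {ω | (fun i => t⁻¹ • Y i ω) ∈ A ∧ t < ‖Y 0 ω‖} =
      ENNReal.ofReal (t ^ (-α)) * P' {ω | (fun i => Y i ω) ∈ A} := by
  have ht0 : 0 < t := by linarith
  have hm1 : Measurable (fun ω i => t⁻¹ • Y i ω) :=
    measurable_pi_lambda _ fun l => (hYm l).const_smul _
  have hm2 : Measurable (fun ω i => Y i ω) := measurable_pi_lambda _ fun l => hYm _
  have h := restrict_eq_of_integral_eq (P'.map (fun ω i => t⁻¹ • Y i ω))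
    ((t ^ (-α)).toNNReal • P'.map (fun ω i => Y i ω)) {0} (fun F hF h0 => by
      rw [integral_smul_nnreal_measure,
        integral_map hm1.aemeasurable hF.cont.measurable.aestronglyMeasurable,
        integral_map hm2.aemeasurable hF.cont.measurable.aestronglyMeasurable,
        hY.integral_scale hXm hRV ht hF (fun y hy => h0 y ⟨0, by simp, hy⟩), NNReal.smul_def,
        Real.coe_toNNReal _ (by positivity), smul_eq_mul])
  have h' := congrArg (fun μ => μ A) h
  simp only [Finset.mem_singleton, forall_eq] at h'
  have hB : MeasurableSet {y : ℤ → E | 1 < ‖y 0‖} :=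
    (measurableSet_lt measurable_const (measurable_pi_apply 0).norm)
  rw [Measure.restrict_apply hA, Measure.restrict_apply hA, Measure.smul_apply,
    Measure.map_apply hm1 (hA.inter hB), Measure.map_apply hm2 (hA.inter hB)] at h'
  have hae := hY.ae_one_lt hXm hYm hRV
  calc _ = P' ((fun ω i => t⁻¹ • Y i ω) ⁻¹' (A ∩ {y | 1 < ‖y 0‖})) := by
        congr 1
        ext ω
        simp only [mem_ofPred_eq, mem_preimage, mem_inter_iff]
        rw [norm_smul, norm_inv, Real.norm_of_nonneg ht0.le, lt_inv_mul_iff₀ ht0, mul_one]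
    _ = _ := h'
    _ = _ := by
        rw [ENNReal.smul_def, smul_eq_mul]
        congr 1
        refine measure_congr ?_
        filter_upwards [hae] with ω hω
        simp only [eq_iff_iff]
        exact ⟨fun h => h.1, fun h => ⟨h, hω⟩⟩

/-! ### The polar decomposition of the tail process -/

lemma measurable_spectral (hYm : ∀ j, Measurable (Y j)) : Measurable (spectral Y) :=
  measurable_pi_lambda _ fun j => ((hYm 0).norm.inv).smul (hYm j)

instance : SFinite (radial α) := by unfold radial; infer_instance

lemma radial_Ioi (hα : 0 < α) {t : ℝ} (ht : 0 < t) :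
    radial α (Ioi t) = ENNReal.ofReal (t ^ (-α)) := by
  have hsub : Ioi t ∩ Ioi 0 = Ioi t := inter_eq_left.2 (Ioi_subset_Ioi ht.le)
  have hint := integrableOn_Ioi_rpow_of_lt (a := -α - 1) (by linarith) ht
  rw [radial, withDensity_apply _ measurableSet_Ioi, Measure.restrict_restrict measurableSet_Ioi,
    hsub, ← ofReal_integral_eq_lintegral_ofReal (hint.const_mul α)]
  · rw [integral_const_mul, integral_Ioi_rpow_of_lt (by linarith) ht]
    congr 1
    have : -α - 1 + 1 = -α := by ring
    rw [this]; field_simp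
  · filter_upwards [ae_restrict_mem measurableSet_Ioi] with z hz
    have : 0 < z := ht.trans hz
    show 0 ≤ _
    positivity

/-- The paths whose normalisation by `‖y 0‖` lies in `A` form a cone, so the factor `t⁻¹` in
`measure_scale` does not affect membership. -/
lemma IsTailProcess.measure_spectral (hXm : ∀ j, Measurable (X j)) (hYm : ∀ j, Measurable (Y j))
    (hRV : IsRegularlyVarying P X α) (hY : IsTailProcess P X P' Y) {t : ℝ} (ht : 1 ≤ t)
    {A : Set (ℤ → E)} (hA : MeasurableSet A) :
    P' {ω | t < ‖Y 0 ω‖ ∧ spectral Y ω ∈ A} =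
      ENNReal.ofReal (t ^ (-α)) * P' (spectral Y ⁻¹' A) := by
  have ht0 : 0 < t := by linarith
  have hm : Measurable (fun (y : ℤ → E) (j : ℤ) => ‖y 0‖⁻¹ • y j) :=
    measurable_pi_lambda _ fun j => ((measurable_pi_apply 0).norm.inv).smul (measurable_pi_apply j)
  have h := hY.measure_scale hXm hYm hRV ht (hm hA)
  refine Eq.trans ?_ h
  congr 1
  ext ω
  simp only [mem_ofPred_eq, mem_preimage]
  rw [and_comm]
  refine and_congr_left fun hω => ?_
  have : spectral Y ω = fun j => ‖t⁻¹ • Y 0 ω‖⁻¹ • t⁻¹ • Y j ω := by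
    ext j
    rw [norm_smul, norm_inv, Real.norm_of_nonneg ht0.le, smul_smul, spectral]
    congr 1
    field_simp
  rw [this]

/-- Under the tail process, `ε |Y₀|` and the spectral tail process are independent, and the
former has the law of the radial measure restricted to `(ε, ∞)`, up to normalisation. -/
lemma IsTailProcess.prod_radial_spectral (hXm : ∀ j, Measurable (X j))
    (hYm : ∀ j, Measurable (Y j))
    (hRV : IsRegularlyVarying P X α) (hY : IsTailProcess P X P' Y) {ε : ℝ} (hε : 0 < ε) :
    ((radial α).restrict (Ioi ε)).prod (P'.map (spectral Y)) =
      ENNReal.ofReal (ε ^ (-α)) • P'.map (fun ω => (ε * ‖Y 0 ω‖, spectral Y ω)) := by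
  have hα := hRV.index_pos
  have hs := measurable_spectral hYm
  have hn : Measurable fun ω => ε * ‖Y 0 ω‖ := (hYm 0).norm.const_mul ε
  have hc : ENNReal.ofReal (ε ^ (-α)) ≠ ∞ := ENNReal.ofReal_ne_top
  have hfin : IsFiniteMeasure ((radial α).restrict (Ioi ε)) := ⟨by
    rw [Measure.restrict_apply_univ, radial_Ioi hα hε]; exact ENNReal.ofReal_lt_top⟩
  refine Measure.prod_eq fun s A hsm hA => ?_
  have hpair : ∀ s : Set ℝ, MeasurableSet s →
      (ENNReal.ofReal (ε ^ (-α)) • P'.map (fun ω => (ε * ‖Y 0 ω‖, spectral Y ω))) (s ×ˢ A) =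
      (ENNReal.ofReal (ε ^ (-α)) • (P'.restrict (spectral Y ⁻¹' A)).map (fun ω => ε * ‖Y 0 ω‖)) s := by
    intro s hsm
    rw [Measure.smul_apply, Measure.smul_apply, Measure.map_apply (hn.prodMk hs) (hsm.prod hA),
      Measure.map_apply hn hsm, Measure.restrict_apply (hn hsm)]
    rfl
  rw [hpair s hsm, Measure.map_apply hs hA, mul_comm ((radial α).restrict (Ioi ε) s),
    ← smul_eq_mul, ← Measure.smul_apply]
  revert s
  intro s hsm
  have : IsFiniteMeasure
      (ENNReal.ofReal (ε ^ (-α)) • (P'.restrict (spectral Y ⁻¹' A)).map (fun ω => ε * ‖Y 0 ω‖)) :=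
    Measure.smul_finite _ hc
  have hval : ∀ t : ℝ, ε ≤ t →
      (ENNReal.ofReal (ε ^ (-α)) • (P'.restrict (spectral Y ⁻¹' A)).map (fun ω => ε * ‖Y 0 ω‖))
        (Ioi t) = (P' (spectral Y ⁻¹' A) • (radial α).restrict (Ioi ε)) (Ioi t) := by
    intro t ht
    have ht0 : 0 < t := hε.trans_le ht
    have h := hY.measure_spectral hXm hYm hRV (t := t / ε) ((one_le_div hε).2 ht) hA
    rw [Measure.smul_apply, Measure.smul_apply, Measure.map_apply hn measurableSet_Ioi,
      Measure.restrict_apply (hn measurableSet_Ioi), Measure.restrict_apply measurableSet_Ioi,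
      inter_eq_left.2 (Ioi_subset_Ioi ht), radial_Ioi hα ht0]
    have e : (fun ω => ε * ‖Y 0 ω‖) ⁻¹' Ioi t ∩ spectral Y ⁻¹' A =
        {ω | t / ε < ‖Y 0 ω‖ ∧ spectral Y ω ∈ A} := by
      ext ω
      simp only [mem_inter_iff, mem_preimage, mem_Ioi, mem_ofPred_eq, div_lt_iff₀ hε, mul_comm ε]
    rw [e, h, smul_eq_mul, smul_eq_mul, ← mul_assoc, ← ENNReal.ofReal_mul (by positivity),
      ← Real.mul_rpow hε.le (by positivity), mul_div_cancel₀ _ hε.ne', mul_comm]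
  have hone := hY.ae_one_lt hXm hYm hRV
  have hfull1 : ∀ᵐ z ∂(ENNReal.ofReal (ε ^ (-α)) •
      (P'.restrict (spectral Y ⁻¹' A)).map (fun ω => ε * ‖Y 0 ω‖)), z ∈ Ioi ε := by
    refine Measure.ae_smul_measure ?_ _
    refine (ae_map_iff hn.aemeasurable measurableSet_Ioi).2 ?_
    refine ae_restrict_of_ae ?_
    filter_upwards [hone] with ω hω
    show ε < ε * ‖Y 0 ω‖
    nlinarith
  have hfull2 : ∀ᵐ z ∂(P' (spectral Y ⁻¹' A) • (radial α).restrict (Ioi ε)), z ∈ Ioi ε :=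
    Measure.ae_smul_measure (ae_restrict_mem measurableSet_Ioi) _
  -- Both measures live on `Ioi ε`, so among the half-lines generating the Borel sets only those
  -- with endpoint at least `ε` have to be compared.
  have hred : ∀ (μ : Measure ℝ), (∀ᵐ z ∂μ, z ∈ Ioi ε) → ∀ t : Set ℝ, μ t = μ (t ∩ Ioi ε) := by
    intro μ hμ t
    refine measure_congr ?_
    filter_upwards [hμ] with z hz
    simp only [eq_iff_iff]
    exact ⟨fun h => ⟨h, hz⟩, fun h => h.1⟩
  have hext := ext_of_generate_finite (C := range (Ioi : ℝ → Set ℝ))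
    (μ := ENNReal.ofReal (ε ^ (-α)) •
      (P'.restrict (spectral Y ⁻¹' A)).map (fun ω => ε * ‖Y 0 ω‖))
    (ν := P' (spectral Y ⁻¹' A) • (radial α).restrict (Ioi ε))
    (by rw [← borel_eq_generateFrom_Ioi]; exact BorelSpace.measurable_eq)
    isPiSystem_Ioi (by
      rintro _ ⟨t, rfl⟩
      rw [hred _ hfull1, hred _ hfull2, Ioi_inter_Ioi]
      exact hval _ le_sup_right)
    (by rw [hred _ hfull1, hred _ hfull2, univ_inter]; exact hval ε le_rfl)
  rw [hext]

/-- For a fixed spectral path, at most one radius gives coordinate `i` the norm `c ≠ 0`, and the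
radial measure has no atoms. With `c = 1` this makes `<` and `≤` interchangeable in conditions on
the past. -/
lemma IsTailProcess.measure_norm_eq (hXm : ∀ j, Measurable (X j))
    (hYm : ∀ j, Measurable (Y j))
    (hRV : IsRegularlyVarying P X α) (hY : IsTailProcess P X P' Y) (i : ℤ) {c : ℝ} (hc : c ≠ 0) :
    P' {ω | ‖Y i ω‖ = c} = 0 := by
  have h := hY.prod_radial_spectral hXm hYm hRV one_pos
  have hs := measurable_spectral hYm
  have hn : Measurable fun ω => (1 : ℝ) * ‖Y 0 ω‖ := (hYm 0).norm.const_mul 1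
  set A : Set (ℝ × (ℤ → E)) := {p | p.1 * ‖p.2 i‖ = c} with hA
  have hAm : MeasurableSet A := by
    have : Measurable fun p : ℝ × (ℤ → E) => p.1 * ‖p.2 i‖ :=
      measurable_fst.mul ((measurable_pi_apply i).comp measurable_snd).norm
    exact this (measurableSet_singleton c)
  have h1 := congrArg (fun μ => μ A) h
  beta_reduce at h1
  simp only [Real.one_rpow, ENNReal.ofReal_one, one_smul] at h1
  rw [Measure.map_apply (hn.prodMk hs) hAm] at h1
  have h2 : (((radial α).restrict (Ioi 1)).prod (P'.map (spectral Y))) A = 0 := by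
    rw [Measure.prod_apply_symm hAm, lintegral_eq_zero_iff (measurable_measure_prodMk_right hAm)]
    refine Eventually.of_forall fun θ => ?_
    have hnull : radial α {z | z * ‖θ i‖ = c} = 0 := by
      refine ((withDensity_absolutelyContinuous _ _).trans
        Measure.absolutelyContinuous_restrict) ?_
      refine measure_mono_null (t := {c / ‖θ i‖}) (fun z (hz : z * ‖θ i‖ = c) => ?_)
        (measure_singleton _)
      have : ‖θ i‖ ≠ 0 := fun h0 => hc (by rw [← hz, h0, mul_zero])
      exact (eq_div_iff this).2 hz
    exact le_antisymm ((Measure.restrict_apply_le _ _).trans hnull.le) zero_le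
  rw [h2] at h1
  rw [← nonpos_iff_eq_zero]
  refine le_trans (measure_mono_ae ?_) h1.symm.le
  filter_upwards [hY.ae_one_lt hXm hYm hRV] with ω hω hi
  show 1 * ‖Y 0 ω‖ * ‖spectral Y ω i‖ = c
  rw [spectral, norm_smul, norm_inv, norm_norm, one_mul, ← mul_assoc,
    mul_inv_cancel₀ (by linarith), one_mul]
  exact hi

variable {r : ℕ → ℕ} {u : ℕ → ℝ}

/-! ### First exceedances in a block -/

/-- The first index in `[1, ∞)` at which the norm exceeds the level `c` is `j`. -/
def firstExceed (X : ℤ → Ω → E) (c : ℝ) (j : ℤ) : Set Ω :=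
  {ω | c < ‖X j ω‖ ∧ ∀ i, 1 ≤ i → i < j → ‖X i ω‖ ≤ c}

lemma measurableSet_firstExceed (hXm : ∀ j, Measurable (X j)) (c : ℝ) (j : ℤ) :
    MeasurableSet (firstExceed X c j) := by
  have : firstExceed X c j = {ω | c < ‖X j ω‖} ∩
      ⋂ i ∈ Ico 1 j, {ω | ‖X i ω‖ ≤ c} := by
    ext; simp [firstExceed]
  rw [this]
  exact (measurableSet_lt measurable_const (hXm j).norm).inter
    (MeasurableSet.biInter (to_countable _) fun i _ =>
      measurableSet_le (hXm i).norm measurable_const)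

lemma disjoint_firstExceed (c : ℝ) {i j : ℤ} (hi : 1 ≤ i) (hj : 1 ≤ j) (hij : i ≠ j) :
    Disjoint (firstExceed X c i) (firstExceed X c j) := by
  rw [Set.disjoint_left]
  rintro ω ⟨h1, h2⟩ ⟨h3, h4⟩
  rcases lt_or_gt_of_ne hij with h | h
  · exact absurd (h4 i hi h) (not_le.2 h1)
  · exact absurd (h2 j hj h) (not_le.2 h3)

lemma sum_firstExceed_inter_le (hXm : ∀ j, Measurable (X j)) (c : ℝ) (I : Finset ℤ)
    (hI : ∀ i ∈ I, 1 ≤ i) (B : Set Ω) :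
    ∑ j ∈ I, P (firstExceed X c j ∩ B) ≤ P B := by
  calc ∑ j ∈ I, P (firstExceed X c j ∩ B) = ∑ j ∈ I, (P.restrict B) (firstExceed X c j) :=
        Finset.sum_congr rfl fun j _ =>
          (Measure.restrict_apply (measurableSet_firstExceed hXm c j)).symm
    _ = (P.restrict B) (⋃ j ∈ I, firstExceed X c j) :=
        (measure_biUnion_finset (fun i hi j hj hij =>
          disjoint_firstExceed c (hI i hi) (hI j hj) hij)
          fun j _ => measurableSet_firstExceed hXm c j).symm
    _ ≤ (P.restrict B) univ := measure_mono (subset_univ _)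
    _ = P B := by rw [Measure.restrict_apply_univ]

lemma exists_firstExceed {c : ℝ} {R : ℤ} {ω : Ω} (h : ∃ j, 1 ≤ j ∧ j ≤ R ∧ c < ‖X j ω‖) :
    ∃ j ∈ Finset.Icc 1 R, ω ∈ firstExceed X c j := by
  obtain ⟨j, hj, hmin⟩ := Int.exists_least_of_bdd
    (P := fun j => 1 ≤ j ∧ j ≤ R ∧ c < ‖X j ω‖) ⟨1, fun z hz => hz.1⟩ h
  refine ⟨j, Finset.mem_Icc.2 ⟨hj.1, hj.2.1⟩, hj.2.2, fun i h1 h2 => ?_⟩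
  by_contra hc
  exact absurd (hmin i ⟨h1, by omega, not_le.1 hc⟩) (by omega)

/-- The event in the anticlustering condition. -/
def farExceed (X : ℤ → Ω → E) (k R : ℕ) (c : ℝ) : Set Ω :=
  {ω | ∃ j : ℤ, (k : ℤ) ≤ |j| ∧ |j| ≤ (R : ℤ) ∧ c < ‖X j ω‖}

/-- Shift the event at `0` to each admissible `j`. Either there is an exceedance of `b` far from
`j`, or `j` is the first exceedance of `a` in the block and the configuration lies in `B`. Events of
the second kind are disjoint in `j`, so their total probability is at most `P B`. -/
lemma block_inequality (hXm : ∀ j, Measurable (X j)) (hX : IsStationary P X)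
    {a b : ℝ} (hba : b ≤ a) (m R : ℕ) {W : Set (ℤ → E)} (hW : MeasurableSet W)
    (hneg : ∀ y ∈ W, ∀ i : ℤ, -m ≤ i → i < 0 → ‖y i‖ ≤ a) (B : Set Ω)
    (hB : ∀ j : ℤ, m < j → j + m ≤ R → ∀ ω, a < ‖X j ω‖ → (fun i => X (i + j) ω) ∈ W →
      (∀ i, (m : ℤ) ≤ |i - j| → |i - j| ≤ R → ‖X i ω‖ ≤ b) → ω ∈ B) :
    ((R - 2 * m : ℕ) : ℝ≥0∞) * P ({ω | a < ‖X 0 ω‖} ∩ {ω | (fun i => X i ω) ∈ W}) ≤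
      R * P ({ω | a < ‖X 0 ω‖} ∩ farExceed X m R b) + P B := by
  -- These are the `j` for which the window `[j - m, j + m]` lies in `[1, R]`; there are `R - 2 * m`
  -- of them, with truncated subtraction when none fits.
  set I : Finset ℤ := Finset.Icc (m + 1 : ℤ) (R - m) with hI
  have hcard : I.card = R - 2 * m := by rw [hI, Int.card_Icc]; omega
  have hD0 : MeasurableSet ({y : ℤ → E | a < ‖y 0‖} ∩ W) :=
    (measurableSet_lt measurable_const (measurable_pi_apply 0).norm).inter hW
  have hF0 : MeasurableSet ({y : ℤ → E | a < ‖y 0‖} ∩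
      {y | ∃ j : ℤ, (m : ℤ) ≤ |j| ∧ |j| ≤ (R : ℤ) ∧ b < ‖y j‖}) := by
    refine (measurableSet_lt measurable_const (measurable_pi_apply 0).norm).inter ?_
    have : {y : ℤ → E | ∃ j : ℤ, (m : ℤ) ≤ |j| ∧ |j| ≤ (R : ℤ) ∧ b < ‖y j‖} =
        ⋃ j ∈ {j : ℤ | (m : ℤ) ≤ |j| ∧ |j| ≤ (R : ℤ)}, {y | b < ‖y j‖} := by
      ext; simp [and_assoc]
    rw [this]
    exact MeasurableSet.biUnion (to_countable _) fun j _ =>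
      measurableSet_lt measurable_const (measurable_pi_apply j).norm
  have hj : ∀ j ∈ I, P ({ω | a < ‖X 0 ω‖} ∩ {ω | (fun i => X i ω) ∈ W}) ≤
      P ({ω | a < ‖X 0 ω‖} ∩ farExceed X m R b) + P (firstExceed X a j ∩ B) := by
    intro j hj
    rw [hI, Finset.mem_Icc] at hj
    have e1 := hX.measure_eq hXm j hD0
    have e2 := hX.measure_eq hXm j hF0
    change _ = P ({ω | a < ‖X 0 ω‖} ∩ {ω | (fun i => X i ω) ∈ W}) at e1
    change _ = P ({ω | a < ‖X 0 ω‖} ∩ farExceed X m R b) at e2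
    rw [← e1, ← e2]
    refine le_trans (measure_mono ?_) (measure_union_le _ _)
    rintro ω ⟨h1, h2⟩
    by_cases hf : ∃ i : ℤ, (m : ℤ) ≤ |i| ∧ |i| ≤ (R : ℤ) ∧ b < ‖X (i + j) ω‖
    · exact Or.inl ⟨h1, hf⟩
    · push Not at hf
      have h1' : a < ‖X j ω‖ := by simpa using h1
      have hf' : ∀ i, (m : ℤ) ≤ |i - j| → |i - j| ≤ R → ‖X i ω‖ ≤ b := fun i hi hi' => by
        simpa using hf (i - j) hi hi'
      refine Or.inr ⟨⟨h1', fun i hi hij => ?_⟩, hB j (by omega) (by omega) ω h1' h2 hf'⟩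
      -- The recent past is controlled by `W`; the remote past by the absence of far exceedances,
      -- since `b ≤ a`.
      by_cases him : j - m ≤ i
      · simpa using hneg _ h2 (i - j) (by omega) (by omega)
      · refine (hf' i ?_ ?_).trans hba
        · rw [abs_of_nonpos (by omega)]; omega
        · rw [abs_of_nonpos (by omega)]; omega
  calc _ = ∑ _j ∈ I, P ({ω | a < ‖X 0 ω‖} ∩ {ω | (fun i => X i ω) ∈ W}) := by
        rw [Finset.sum_const, hcard, nsmul_eq_mul]
    _ ≤ ∑ j ∈ I, (P ({ω | a < ‖X 0 ω‖} ∩ farExceed X m R b) + P (firstExceed X a j ∩ B)) :=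
        Finset.sum_le_sum hj
    _ = ((R - 2 * m : ℕ) : ℝ≥0∞) * P ({ω | a < ‖X 0 ω‖} ∩ farExceed X m R b) +
          ∑ j ∈ I, P (firstExceed X a j ∩ B) := by
        rw [Finset.sum_add_distrib, Finset.sum_const, hcard, nsmul_eq_mul]
    _ ≤ _ := by
        gcongr
        · omega
        · exact sum_firstExceed_inter_le hXm a I (fun i hi => by
            rw [hI, Finset.mem_Icc] at hi; omega) B

/-! ### Asymptotic form of the block inequality. -/

lemma tendsto_sub_div (hr : Tendsto r atTop atTop) (m : ℕ) :
    Tendsto (fun n => ((r n - m : ℕ) : ℝ≥0∞) / (r n : ℝ≥0∞)) atTop (𝓝 1) := by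
  have h1 : Tendsto (fun n => (m : ℝ≥0∞) / (r n : ℝ≥0∞)) atTop (𝓝 0) := by
    have := ENNReal.Tendsto.const_div (a := (m : ℝ≥0∞)) (m := fun n => (r n : ℝ≥0∞)) (b := ∞)
      (f := atTop) (ENNReal.tendsto_nat_nhds_top.comp hr) (Or.inr (by simp))
    simpa using this
  have h2 : Tendsto (fun n => (1 : ℝ≥0∞) - (m : ℝ≥0∞) / (r n : ℝ≥0∞)) atTop (𝓝 (1 - 0)) :=
    ENNReal.Tendsto.sub tendsto_const_nhds h1 (Or.inl ENNReal.one_ne_top)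
  rw [tsub_zero] at h2
  refine h2.congr' ?_
  filter_upwards [hr.eventually_ge_atTop 1] with n hn
  have h0 : (r n : ℝ≥0∞) ≠ 0 := by simp; omega
  rw [ENNReal.natCast_sub, ENNReal.sub_div (fun _ _ => h0), ENNReal.div_self h0 (by simp)]

lemma IsRegularlyVarying.tail_seq (hRV : IsRegularlyVarying P X α) (hu : Tendsto u atTop atTop)
    {ε : ℝ} (hε : 0 < ε) :
    Tendsto (fun n => P {ω | ε * u n < ‖X 0 ω‖} / P {ω | u n < ‖X 0 ω‖}) atTop
      (𝓝 (ENNReal.ofReal (ε ^ (-α)))) :=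
  (hRV.tail_ennreal hε).comp hu

lemma liminf_le_liminf_comp {ι κ : Type*} {f : Filter ι} {g : Filter κ} {v : ι → κ}
    (hv : Tendsto v f g) (φ : κ → ℝ≥0∞) : liminf φ g ≤ liminf (fun n => φ (v n)) f :=
  liminf_le_liminf_of_le (u := φ) hv

lemma limsup_comp_le_limsup {ι κ : Type*} {f : Filter ι} {g : Filter κ} {v : ι → κ}
    (hv : Tendsto v f g) (φ : κ → ℝ≥0∞) : limsup (fun n => φ (v n)) f ≤ limsup φ g :=
  limsup_le_limsup_of_le (u := φ) hv

lemma normalize_inequality {a R q p w d b : ℝ≥0∞} (hR0 : R ≠ 0) (hR : R ≠ ∞)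
    (h : a * (q * w) ≤ R * (q * d) + b) : a / R * (q / p) * w ≤ q / p * d + b / (R * p) := by
  have hinv : (R * p)⁻¹ = R⁻¹ * p⁻¹ := ENNReal.mul_inv (Or.inl hR0) (Or.inl hR)
  calc a / R * (q / p) * w = a * (q * w) * (R * p)⁻¹ := by
        rw [hinv]; simp only [div_eq_mul_inv]; ring
    _ ≤ (R * (q * d) + b) * (R * p)⁻¹ := by gcongr
    _ = R * R⁻¹ * (q / p * d) + b / (R * p) := by
        simp only [div_eq_mul_inv, hinv, add_mul]; ring
    _ = _ := by rw [ENNReal.mul_inv_cancel hR0 hR, one_mul]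

lemma ennreal_liminf_add_le (u v : ℕ → ℝ≥0∞) :
    liminf (fun n => u n + v n) atTop ≤ limsup u atTop + liminf v atTop := by
  by_cases hL : limsup u atTop = ∞
  · rw [hL, top_add]; exact le_top
  refine ENNReal.le_of_forall_pos_le_add fun η hη _ => ?_
  have h1 : ∀ᶠ n in atTop, u n < limsup u atTop + η :=
    eventually_lt_of_limsup_lt (ENNReal.lt_add_right hL (by simpa using hη.ne'))
  calc liminf (fun n => u n + v n) atTop
      ≤ liminf (fun n => (limsup u atTop + η) + v n) atTop :=
        liminf_le_liminf (h1.mono fun n hn => add_le_add_left hn.le _)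
    _ = (limsup u atTop + η) + liminf v atTop :=
        (Monotone.map_liminf_of_continuousAt (f := fun x => (limsup u atTop + η) + x)
          (fun _ _ h => add_le_add_right h _) v (by fun_prop)).symm
    _ = _ := by ring

lemma ennreal_limsup_add_le (u v : ℕ → ℝ≥0∞) :
    limsup (fun n => u n + v n) atTop ≤ limsup u atTop + limsup v atTop := by
  by_cases hL : limsup u atTop = ∞
  · rw [hL, top_add]; exact le_top
  refine ENNReal.le_of_forall_pos_le_add fun η hη _ => ?_
  have h1 : ∀ᶠ n in atTop, u n < limsup u atTop + η :=
    eventually_lt_of_limsup_lt (ENNReal.lt_add_right hL (by simpa using hη.ne'))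
  calc limsup (fun n => u n + v n) atTop
      ≤ limsup (fun n => (limsup u atTop + η) + v n) atTop :=
        limsup_le_limsup (h1.mono fun n hn => add_le_add_left hn.le _)
    _ = (limsup u atTop + η) + limsup v atTop :=
        (Monotone.map_limsup_of_continuousAt (f := fun x => (limsup u atTop + η) + x)
          (fun _ _ h => add_le_add_right h _) v (by fun_prop)).symm
    _ = _ := by ring

/-- Asymptotic lower bound for the probability of events `B n` that contain, outside the
anticlustering event, every configuration whose first exceedance of `ε u_n` looks like `W`. -/
lemma block_bound (hXm : ∀ j, Measurable (X j)) (hYm : ∀ j, Measurable (Y j))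
    (hX : IsStationary P X) (hRV : IsRegularlyVarying P X α) (hY : IsTailProcess P X P' Y)
    (hr : Tendsto r atTop atTop) (hu : Tendsto u atTop atTop)
    {ε δ : ℝ} (hε : 0 < ε) (hδ : δ ≤ ε) (m : ℕ) {W : Set (ℤ → E)} (hW : IsOpen W)
    (hdep : ∀ x y : ℤ → E, (∀ i ∈ Finset.Icc (-(m : ℤ)) m, x i = y i) → x ∈ W → y ∈ W)
    (hneg : ∀ y ∈ W, ∀ i : ℤ, -m ≤ i → i < 0 → ‖y i‖ ≤ 1) (B : ℕ → Set Ω)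
    (hB : ∀ᶠ n in atTop, ∀ j : ℤ, m < j → j + m ≤ r n → ∀ ω, ε * u n < ‖X j ω‖ →
      (fun i => (ε * u n)⁻¹ • X (i + j) ω) ∈ W →
      (∀ i, (m : ℤ) ≤ |i - j| → |i - j| ≤ r n → ‖X i ω‖ ≤ δ * u n) → ω ∈ B n) :
    ENNReal.ofReal (ε ^ (-α)) * P' {ω | (fun j => Y j ω) ∈ W} ≤
      ENNReal.ofReal (ε ^ (-α)) * limsup (fun n => ProbabilityTheory.cond P {ω | u n * ε < ‖X 0 ω‖}
        (farExceed X m (r n) (u n * δ))) atTop +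
      liminf (fun n => P (B n) / (r n * P {ω | u n < ‖X 0 ω‖})) atTop := by
  set q : ℕ → ℝ≥0∞ := fun n => P {ω | ε * u n < ‖X 0 ω‖}
  set p : ℕ → ℝ≥0∞ := fun n => P {ω | u n < ‖X 0 ω‖}
  set c := ENNReal.ofReal (ε ^ (-α))
  set w : ℕ → ℝ≥0∞ := fun n => ProbabilityTheory.cond P {ω | ε * u n < ‖X 0 ω‖}
    {ω | (fun i => (ε * u n)⁻¹ • X i ω) ∈ W}
  set d : ℕ → ℝ≥0∞ := fun n => ProbabilityTheory.cond P {ω | u n * ε < ‖X 0 ω‖}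
        (farExceed X m (r n) (u n * δ))
  have hq0 : ∀ n, q n ≠ 0 := fun n => (hRV.tail_pos _).ne'
  have hp0 : ∀ n, p n ≠ 0 := fun n => (hRV.tail_pos _).ne'
  have hqp : Tendsto (fun n => q n / p n) atTop (𝓝 c) := hRV.tail_seq hu hε
  have hmq : ∀ n, MeasurableSet {ω | ε * u n < ‖X 0 ω‖} := fun n =>
    measurableSet_lt measurable_const (hXm 0).norm
  have hcond : ∀ n (A : Set Ω), P ({ω | ε * u n < ‖X 0 ω‖} ∩ A) =
      q n * ProbabilityTheory.cond P {ω | ε * u n < ‖X 0 ω‖} A := fun n A => by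
    rw [ProbabilityTheory.cond_apply (hmq n), ← mul_assoc,
      ENNReal.mul_inv_cancel (hq0 n) (measure_ne_top _ _), one_mul]
  have hfin : ∀ᶠ n in atTop, ((r n - 2 * m : ℕ) : ℝ≥0∞) / r n * (q n / p n) * w n ≤
      q n / p n * d n + P (B n) / (r n * p n) := by
    filter_upwards [hB, hr.eventually_ge_atTop 1, hu.eventually_gt_atTop 0] with n hBn hrn hun
    have hεu : 0 < ε * u n := mul_pos hε hun
    have hr0 : (r n : ℝ≥0∞) ≠ 0 := by simp; omega
    have hineq := block_inequality (P := P) (a := ε * u n) (b := δ * u n) hXm hX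
      (by gcongr) m (r n)
      (W := {y | (fun i => (ε * u n)⁻¹ • y i) ∈ W})
      ((hW.preimage (by fun_prop : Continuous fun (y : ℤ → E) i => (ε * u n)⁻¹ • y i)).measurableSet)
      (fun y hy i h1 h2 => by
        have := hneg _ hy i h1 h2
        rw [norm_smul, norm_inv, Real.norm_of_nonneg hεu.le, inv_mul_le_iff₀ hεu] at this
        linarith) (B n) hBn
    rw [hcond, hcond] at hineq
    have hdn : ProbabilityTheory.cond P {ω | ε * u n < ‖X 0 ω‖} (farExceed X m (r n) (δ * u n)) =
        d n := by simp only [d, mul_comm (u n)]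
    rw [hdn] at hineq
    change ((r n - 2 * m : ℕ) : ℝ≥0∞) * (q n * w n) ≤ r n * (q n * d n) + P (B n) at hineq
    exact normalize_inequality hr0 (by simp) hineq
  have hw : P' {ω | (fun j => Y j ω) ∈ W} ≤ liminf w atTop :=
    (hY.le_liminf_open hXm hYm hRV hW hdep).trans
      (liminf_le_liminf_comp (hu.const_mul_atTop hε) _)
  have hlhs : Tendsto (fun n => ((r n - 2 * m : ℕ) : ℝ≥0∞) / r n * (q n / p n)) atTop (𝓝 c) := by
    have := ENNReal.Tendsto.mul (tendsto_sub_div hr (2 * m)) (Or.inl one_ne_zero) hqp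
      (Or.inr ENNReal.one_ne_top)
    rwa [one_mul] at this
  -- Finiteness is what permits bounding the limsup of the product below, where `0 * ∞` must be
  -- excluded.
  have hd1 : limsup d atTop ≤ 1 := by
    refine limsup_le_of_le (by isBoundedDefault) (Eventually.of_forall fun n => ?_)
    have := ProbabilityTheory.cond_isProbabilityMeasure (μ := P) (s := {ω | u n * ε < ‖X 0 ω‖})
      (hRV.tail_pos _).ne'
    exact prob_le_one
  have hmul : limsup (fun n => q n / p n * d n) atTop ≤ c * limsup d atTop := by
    have := ENNReal.limsup_mul_le' (f := atTop) (u := fun n => q n / p n) (v := d)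
      (Or.inr (hd1.trans_lt ENNReal.one_lt_top).ne)
      (Or.inl (by rw [hqp.limsup_eq]; exact ENNReal.ofReal_ne_top))
    rwa [hqp.limsup_eq] at this
  have h1 : c * P' {ω | (fun j => Y j ω) ∈ W} ≤
      liminf (fun n => ((r n - 2 * m : ℕ) : ℝ≥0∞) / r n * (q n / p n) * w n) atTop := by
    refine le_trans (mul_le_mul' hlhs.liminf_eq.ge hw) ?_
    exact ENNReal.le_liminf_mul (f := atTop)
      (u := fun n => ((r n - 2 * m : ℕ) : ℝ≥0∞) / r n * (q n / p n)) (v := w)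
  have h2 : liminf (fun n => q n / p n * d n + P (B n) / (r n * p n)) atTop ≤
      limsup (fun n => q n / p n * d n) atTop + liminf (fun n => P (B n) / (r n * p n)) atTop :=
    ennreal_liminf_add_le _ _
  exact (h1.trans (liminf_le_liminf hfin)).trans (h2.trans (add_le_add_left hmul _))

/-! ### The tail process tends to zero -/

/-- A Fatou inequality for sets. No measurability is needed, because continuity from below along
increasing unions holds for arbitrary sets. -/
lemma measure_le_liminf_of_eventually_mem {N : Set Ω} {A : ℕ → Set Ω}
    (h : ∀ ω ∈ N, ∀ᶠ m in atTop, ω ∈ A m) : P N ≤ liminf (fun m => P (A m)) atTop := by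
  have hsub : N ⊆ ⋃ k, ⋂ m ≥ k, A m := fun ω hω => by
    obtain ⟨k, hk⟩ := eventually_atTop.1 (h ω hω)
    exact mem_iUnion.2 ⟨k, mem_iInter₂.2 hk⟩
  have hmono : Monotone fun k => ⋂ m ≥ k, A m := fun k l hkl =>
    biInter_mono (fun m (hm : l ≤ m) => hkl.trans hm) fun _ _ => subset_rfl
  refine (measure_mono hsub).trans ?_
  rw [hmono.measure_iUnion, liminf_eq_iSup_iInf_of_nat]
  exact iSup_mono fun k => le_iInf₂ fun m hm => measure_mono (biInter_subset_of_mem hm)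

lemma measure_zero_of_le_tendsto {N : Set Ω} {ι : Type*} {f : Filter ι} [f.NeBot] {a : ι → ℝ≥0∞}
    (ha : Tendsto a f (𝓝 0)) (h : ∀ᶠ i in f, P N ≤ a i) : P N = 0 :=
  le_antisymm (ge_of_tendsto ha h) zero_le

/-- An exceedance of `Y` at some `j` with `k ≤ |j| ≤ m` is an open cylinder event. Its probability
is bounded by the anticlustering limsup at `k`, uniformly in `m`. Let `m → ∞`, then `k → ∞`. -/
lemma IsTailProcess.tendsto_zero (hXm : ∀ j, Measurable (X j)) (hYm : ∀ j, Measurable (Y j))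
    (hRV : IsRegularlyVarying P X α) (hY : IsTailProcess P X P' Y)
    (hr : Tendsto r atTop atTop) (hu : Tendsto u atTop atTop) (hDH : ConditionDH P X r u) :
    ∀ᵐ ω ∂P', Tendsto (fun j : ℤ => Y j ω) cofinite (𝓝 0) := by
  have key : ∀ x : ℝ, 0 < x → ∀ᵐ ω ∂P', ∃ k : ℕ, ∀ j : ℤ, (k : ℤ) ≤ |j| → ‖Y j ω‖ ≤ x := by
    intro x hx
    have hkm : ∀ k m : ℕ, P' {ω | ∃ j : ℤ, (k : ℤ) ≤ |j| ∧ |j| ≤ (m : ℤ) ∧ x < ‖Y j ω‖} ≤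
        limsup (fun n => ProbabilityTheory.cond P {ω | u n * 1 < ‖X 0 ω‖}
          (farExceed X k (r n) (u n * x))) atTop := by
      intro k m
      set W : Set (ℤ → E) := {y | ∃ j : ℤ, (k : ℤ) ≤ |j| ∧ |j| ≤ (m : ℤ) ∧ x < ‖y j‖} with hWdef
      have hW : IsOpen W := by
        have : W = ⋃ j ∈ {j : ℤ | (k : ℤ) ≤ |j| ∧ |j| ≤ (m : ℤ)}, {y : ℤ → E | x < ‖y j‖} := by
          ext; simp [hWdef, and_assoc]
        rw [this]
        exact isOpen_biUnion fun j _ => isOpen_lt continuous_const (continuous_apply j).norm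
      have h := (hY.le_liminf_open hXm hYm hRV hW (S := Finset.Icc (-(m : ℤ)) m)
        (fun a b hab ⟨j, h1, h2, h3⟩ => ⟨j, h1, h2, by
          rwa [← hab j (Finset.mem_Icc.2 (abs_le.1 h2))]⟩)).trans (liminf_le_liminf_comp hu _)
      -- As `r n ≥ m` eventually, the range `|j| ≤ m` can be enlarged to `|j| ≤ r n`, which removes
      -- the dependence on `m`.
      refine h.trans ((liminf_le_liminf ?_).trans liminf_le_limsup)
      filter_upwards [hu.eventually_gt_atTop 0, hr.eventually_ge_atTop m] with n hun hrn
      rw [mul_one]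
      refine measure_mono ?_
      rintro ω ⟨j, h1, h2, h3⟩
      refine ⟨j, h1, h2.trans (by exact_mod_cast hrn), ?_⟩
      rwa [norm_smul, norm_inv, Real.norm_of_nonneg hun.le, lt_inv_mul_iff₀ hun] at h3
    have hk : ∀ k : ℕ, P' {ω | ∃ j : ℤ, (k : ℤ) ≤ |j| ∧ x < ‖Y j ω‖} ≤
        limsup (fun n => ProbabilityTheory.cond P {ω | u n * 1 < ‖X 0 ω‖}
          (farExceed X k (r n) (u n * x))) atTop := by
      intro k
      refine (measure_le_liminf_of_eventually_mem (A := fun m : ℕ =>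
        {ω | ∃ j : ℤ, (k : ℤ) ≤ |j| ∧ |j| ≤ (m : ℤ) ∧ x < ‖Y j ω‖}) ?_).trans ?_
      · rintro ω ⟨j, h1, h2⟩
        filter_upwards [eventually_ge_atTop j.natAbs] with m hm
        exact ⟨j, h1, by rw [Int.abs_eq_natAbs]; exact_mod_cast hm, h2⟩
      · exact (liminf_le_liminf (Eventually.of_forall fun m => hkm k m)).trans_eq
          (by rw [liminf_const])
    rw [ae_iff]
    refine measure_zero_of_le_tendsto (hDH x 1 hx one_pos) (Eventually.of_forall fun k => ?_)
    refine (measure_mono fun ω hω => ?_).trans (hk k)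
    have hω' : ¬ ∃ k : ℕ, ∀ j : ℤ, (k : ℤ) ≤ |j| → ‖Y j ω‖ ≤ x := hω
    push Not at hω'
    exact hω' k
  have hall : ∀ᵐ ω ∂P', ∀ q : ℕ, ∃ k : ℕ, ∀ j : ℤ, (k : ℤ) ≤ |j| → ‖Y j ω‖ ≤ 1 / ((q : ℝ) + 1) :=
    ae_all_iff.2 fun q => key _ (by positivity)
  filter_upwards [hall] with ω hω
  rw [Metric.tendsto_nhds]
  intro e he
  obtain ⟨q, hq⟩ := exists_nat_one_div_lt he
  obtain ⟨k, hk⟩ := hω q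
  rw [eventually_cofinite]
  refine (finite_Ioo (-(k : ℤ)) k).subset fun j hj => ?_
  have hj' : ¬ dist (Y j ω) 0 < e := hj
  rw [dist_zero_right] at hj'
  by_contra hc
  refine hj' ((hk j ?_).trans_lt hq)
  rw [mem_Ioo, ← abs_lt] at hc
  omega

/-! ### Anchoring -/

/-- An anchoring map for the process `Y`, encoded by the sets `A j` of sequences anchored
at `j`. -/
structure IsAnchor (P' : Measure Ω') (Y : ℤ → Ω' → E) (A : ℤ → Set (ℤ → E)) : Prop where
  meas : ∀ j, MeasurableSet (A j)
  shift : ∀ (y : ℤ → E) (j k : ℤ), (fun i => y (i - k)) ∈ A j ↔ y ∈ A (j - k)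
  disj : ∀ i j, i ≠ j → Disjoint (A i) (A j)
  cover : ∀ᵐ ω ∂P', ∃ j, (fun i => Y i ω) ∈ A j
  exceed : ∀ᵐ ω ∂P', ∀ j, (fun i => Y i ω) ∈ A j → 1 < ‖Y j ω‖

lemma IsAnchor.measure_eq_tsum {A : ℤ → Set (ℤ → E)} (hA : IsAnchor P' Y A)
    (hYm : ∀ j, Measurable (Y j)) {S : Set Ω'} (hS : MeasurableSet S) :
    P' S = ∑' j, P' (S ∩ {ω | (fun i => Y i ω) ∈ A j}) := by
  have hm : Measurable (fun ω i => Y i ω) := measurable_pi_lambda _ fun l => hYm l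
  rw [← measure_iUnion]
  · refine measure_congr ?_
    filter_upwards [hA.cover] with ω ⟨j, hj⟩
    simp only [eq_iff_iff]
    exact ⟨fun h => mem_iUnion.2 ⟨j, h, hj⟩, fun h => by
      obtain ⟨j, hj⟩ := mem_iUnion.1 h; exact hj.1⟩
  · intro i j hij
    refine Set.disjoint_left.2 fun ω h1 h2 => ?_
    exact Set.disjoint_left.1 (hA.disj i j hij) h1.2 h2.2
  · exact fun j => hS.inter (hm (hA.meas j))

/-- The cluster distribution does not depend on the anchoring map. -/
lemma IsAnchor.measure_eq {A A' : ℤ → Set (ℤ → E)} (hA : IsAnchor P' Y A) (hA' : IsAnchor P' Y A')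
    (hXm : ∀ j, Measurable (X j)) (hYm : ∀ j, Measurable (Y j))
    (hX : IsStationary P X) (hRV : IsRegularlyVarying P X α) (hY : IsTailProcess P X P' Y)
    {G : Set (ℤ → E)} (hG : MeasurableSet G)
    (hGs : ∀ (y : ℤ → E) (k : ℤ), (fun i => y (i - k)) ∈ G ↔ y ∈ G) :
    P' {ω | (fun i => Y i ω) ∈ G ∩ A 0} = P' {ω | (fun i => Y i ω) ∈ G ∩ A' 0} := by
  have hm : Measurable (fun ω i => Y i ω) := measurable_pi_lambda _ fun l => hYm l
  -- Moving the origin to `j` turns "`A` anchors at `0`, `A'` at `j`" into "`A'` anchors at `0`, `A`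
  -- at `-j`". The exceedances required by the time change formula are automatic at anchors.
  -- Summation over `j` then finishes the proof.
  have hswap : ∀ j, P' ({ω | (fun i => Y i ω) ∈ G ∩ A 0} ∩ {ω | (fun i => Y i ω) ∈ A' j}) =
      P' ({ω | (fun i => Y i ω) ∈ G ∩ A' 0} ∩ {ω | (fun i => Y i ω) ∈ A (-j)}) := by
    intro j
    have h := hY.time_change hXm hYm hX hRV j (A := G ∩ A 0 ∩ A' j)
      ((hG.inter (hA.meas 0)).inter (hA'.meas j))
    calc _ = P' {ω | (fun i => Y i ω) ∈ G ∩ A 0 ∩ A' j ∧ 1 < ‖Y j ω‖} := by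
          refine measure_congr ?_
          filter_upwards [hA'.exceed] with ω hω
          simp only [eq_iff_iff]
          exact ⟨fun h => ⟨h, hω j h.2⟩, fun h => h.1⟩
      _ = _ := h
      _ = _ := by
          refine measure_congr ?_
          filter_upwards [hA.exceed] with ω hω
          simp only [eq_iff_iff]
          have e1 := hGs (fun i => Y i ω) j
          have e2 := hA.shift (fun i => Y i ω) 0 j
          have e3 := hA'.shift (fun i => Y i ω) j j
          rw [zero_sub] at e2
          rw [sub_self] at e3
          exact ⟨fun h => ⟨⟨e1.1 h.1.1.1, e3.1 h.1.2⟩, e2.1 h.1.1.2⟩,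
            fun h => ⟨⟨⟨e1.2 h.1.1, e2.2 h.2⟩, e3.2 h.1.2⟩, hω _ h.2⟩⟩
  have e1 := hA'.measure_eq_tsum hYm (hm (hG.inter (hA.meas 0)))
  have e2 := hA.measure_eq_tsum hYm (hm (hG.inter (hA'.meas 0)))
  rw [← (Equiv.neg ℤ).tsum_eq] at e2
  exact e1.trans ((tsum_congr hswap).trans e2.symm)

/-- If a shift-invariant event has probability zero when anchored at `0`, it has
probability zero. -/
lemma IsAnchor.measure_eq_zero {A : ℤ → Set (ℤ → E)} (hA : IsAnchor P' Y A)
    (hXm : ∀ j, Measurable (X j)) (hYm : ∀ j, Measurable (Y j))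
    (hX : IsStationary P X) (hRV : IsRegularlyVarying P X α) (hY : IsTailProcess P X P' Y)
    {G : Set (ℤ → E)} (hG : MeasurableSet G)
    (hGs : ∀ (y : ℤ → E) (k : ℤ), (fun i => y (i - k)) ∈ G ↔ y ∈ G)
    (h0 : P' {ω | (fun i => Y i ω) ∈ G ∩ A 0} = 0) : P' {ω | (fun i => Y i ω) ∈ G} = 0 := by
  have hm : Measurable (fun ω i => Y i ω) := measurable_pi_lambda _ fun l => hYm l
  refine (hA.measure_eq_tsum hYm (hm hG)).trans (ENNReal.tsum_eq_zero.2 fun j => ?_)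
  have h := hY.time_change hXm hYm hX hRV j (hG.inter (hA.meas j))
  refine le_antisymm ?_ zero_le
  calc _ = P' {ω | (fun i => Y i ω) ∈ G ∩ A j ∧ 1 < ‖Y j ω‖} := by
        refine measure_congr ?_
        filter_upwards [hA.exceed] with ω hω
        simp only [eq_iff_iff]
        exact ⟨fun h => ⟨h, hω j h.2⟩, fun h => h.1⟩
    _ = _ := h
    _ ≤ P' {ω | (fun i => Y i ω) ∈ G ∩ A 0} := by
        refine measure_mono fun ω hω => ⟨(hGs (fun i => Y i ω) j).1 hω.1.1, ?_⟩
        have := (hA.shift (fun i => Y i ω) j j).1 hω.1.2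
        rwa [sub_self] at this
    _ = 0 := h0

/-- The sequences whose first exceedance of level `1` is at `j`. -/
def firstExceedAt (j : ℤ) : Set (ℤ → E) := {y | 1 < ‖y j‖ ∧ ∀ i < j, ‖y i‖ ≤ 1}

/-- The sequences whose norm is maximal for the first time at `j`. -/
def firstArgmaxAt (j : ℤ) : Set (ℤ → E) := {y | (∀ i, ‖y i‖ ≤ ‖y j‖) ∧ ∀ i < j, ‖y i‖ < ‖y j‖}

lemma finite_le_norm {y : ℤ → E} (hy : Tendsto y cofinite (𝓝 0)) {c : ℝ} (hc : 0 < c) :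
    {i | c ≤ ‖y i‖}.Finite := by
  have h := (tendsto_norm_zero.comp hy).eventually_lt_const hc
  rw [eventually_cofinite] at h
  simpa using h

lemma exists_firstArgmaxAt {y : ℤ → E} (hy : Tendsto y cofinite (𝓝 0)) (h0 : 1 < ‖y 0‖) :
    ∃ j, y ∈ firstArgmaxAt j := by
  have hfin := finite_le_norm hy one_pos
  obtain ⟨k, hk, hmax⟩ := exists_max_image _ (fun i => ‖y i‖) hfin ⟨0, h0.le⟩
  have hmax' : ∀ i, ‖y i‖ ≤ ‖y k‖ := fun i => by
    by_cases hi : 1 ≤ ‖y i‖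
    · exact hmax i hi
    · exact (not_le.1 hi).le.trans hk
  have hfin2 : {i | ‖y k‖ ≤ ‖y i‖}.Finite := hfin.subset fun i (hi : ‖y k‖ ≤ ‖y i‖) => by
    show 1 ≤ ‖y i‖
    exact le_trans hk hi
  obtain ⟨j, hj, hmin⟩ := exists_min_image _ id hfin2 ⟨k, by show ‖y k‖ ≤ ‖y k‖; exact le_rfl⟩
  refine ⟨j, fun i => (hmax' i).trans hj, fun i hi => ?_⟩
  by_contra hc
  exact absurd (hmin i (le_trans hj (not_lt.1 hc))) (not_le.2 hi)

lemma exists_firstExceedAt {y : ℤ → E} (hy : Tendsto y cofinite (𝓝 0)) (h0 : 1 < ‖y 0‖) :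
    ∃ j, y ∈ firstExceedAt j := by
  have hfin : {i | 1 < ‖y i‖}.Finite :=
    (finite_le_norm hy one_pos).subset fun i (hi : 1 < ‖y i‖) => by
      show 1 ≤ ‖y i‖
      exact hi.le
  obtain ⟨j, hj, hmin⟩ := exists_min_image _ id hfin ⟨0, h0⟩
  refine ⟨j, hj, fun i hi => ?_⟩
  by_contra hc
  exact absurd (hmin i (not_le.1 hc)) (not_le.2 hi)

lemma measurableSet_firstExceedAt (j : ℤ) : MeasurableSet (firstExceedAt (E := E) j) := by
  have : firstExceedAt (E := E) j = {y | 1 < ‖y j‖} ∩ ⋂ i ∈ Iio j, {y | ‖y i‖ ≤ 1} := by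
    ext; simp [firstExceedAt]
  rw [this]
  exact (measurableSet_lt measurable_const (measurable_pi_apply j).norm).inter
    (MeasurableSet.biInter (to_countable _) fun i _ =>
      measurableSet_le (measurable_pi_apply i).norm measurable_const)

lemma measurableSet_firstArgmaxAt (j : ℤ) : MeasurableSet (firstArgmaxAt (E := E) j) := by
  have : firstArgmaxAt (E := E) j =
      (⋂ i, {y | ‖y i‖ ≤ ‖y j‖}) ∩ ⋂ i ∈ Iio j, {y | ‖y i‖ < ‖y j‖} := by
    ext; simp [firstArgmaxAt]
  rw [this]
  exact (MeasurableSet.iInter fun i =>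
      measurableSet_le (measurable_pi_apply i).norm (measurable_pi_apply j).norm).inter
    (MeasurableSet.biInter (to_countable _) fun i _ =>
      measurableSet_lt (measurable_pi_apply i).norm (measurable_pi_apply j).norm)

lemma isAnchor_firstExceedAt (h1 : ∀ᵐ ω ∂P', 1 < ‖Y 0 ω‖)
    (h2 : ∀ᵐ ω ∂P', Tendsto (fun j : ℤ => Y j ω) cofinite (𝓝 0)) :
    IsAnchor P' Y firstExceedAt where
  meas := measurableSet_firstExceedAt
  shift y j k := by
    refine and_congr Iff.rfl ⟨fun h i hi => ?_, fun h i hi => h _ (by omega)⟩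
    simpa using h (i + k) (by omega)
  disj i j hij := by
    rw [Set.disjoint_left]
    rintro y ⟨h1, h2⟩ ⟨h3, h4⟩
    rcases lt_or_gt_of_ne hij with h | h
    · exact absurd (h4 i h) (not_le.2 h1)
    · exact absurd (h2 j h) (not_le.2 h3)
  cover := by
    filter_upwards [h1, h2] with ω ha hb
    exact exists_firstExceedAt hb ha
  exceed := Eventually.of_forall fun ω j h => h.1

lemma isAnchor_firstArgmaxAt (h1 : ∀ᵐ ω ∂P', 1 < ‖Y 0 ω‖)
    (h2 : ∀ᵐ ω ∂P', Tendsto (fun j : ℤ => Y j ω) cofinite (𝓝 0)) :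
    IsAnchor P' Y firstArgmaxAt where
  meas := measurableSet_firstArgmaxAt
  shift y j k := by
    refine and_congr ⟨fun h i => ?_, fun h i => h _⟩
      ⟨fun h i hi => ?_, fun h i hi => h _ (by omega)⟩
    · simpa using h (i + k)
    · simpa using h (i + k) (by omega)
  disj i j hij := by
    rw [Set.disjoint_left]
    rintro y ⟨h1, h2⟩ ⟨h3, h4⟩
    rcases lt_or_gt_of_ne hij with h | h
    · exact absurd (h1 j) (not_le.2 (h4 i h))
    · exact absurd (h3 i) (not_le.2 (h2 j h))
  cover := by
    filter_upwards [h1, h2] with ω ha hb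
    exact exists_firstArgmaxAt hb ha
  exceed := by
    filter_upwards [h1] with ω ha j hj
    exact ha.trans_le (hj.1 0)

/-! ### Summable sequences and Lipschitz functionals -/

/-- Truncation of a sequence to the window `[-m, m]`. -/
def trunc (m : ℕ) (y : ℤ → E) : ℤ → E := fun i => if i ∈ Finset.Icc (-(m : ℤ)) m then y i else 0

lemma memL1_of_finset {y : ℤ → E} (S : Finset ℤ) (h : ∀ i ∉ S, y i = 0) : MemL1 y :=
  summable_of_ne_finset_zero (s := S) fun i hi => by rw [h i hi, norm_zero]

lemma memL1_trunc (m : ℕ) (y : ℤ → E) : MemL1 (trunc m y) :=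
  memL1_of_finset (Finset.Icc (-(m : ℤ)) m) fun _ hi => if_neg hi

lemma MemL1.sub {x y : ℤ → E} (hx : MemL1 x) (hy : MemL1 y) : Summable fun j => ‖x j - y j‖ :=
  Summable.of_nonneg_of_le (fun _ => norm_nonneg _) (fun _ => norm_sub_le _ _) (Summable.add hx hy)

lemma MemL1.smul {x : ℤ → E} (hx : MemL1 x) (c : ℝ) : MemL1 (fun j => c • x j) := by
  simpa [MemL1, norm_smul] using Summable.mul_left ‖c‖ hx

lemma MemL1.shift {x : ℤ → E} (hx : MemL1 x) (k : ℤ) : MemL1 (fun j => x (j + k)) :=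
  (Equiv.addRight k).summable_iff.2 hx

lemma memL1_shift_iff {x : ℤ → E} (k : ℤ) : MemL1 (fun j => x (j + k)) ↔ MemL1 x :=
  ⟨fun h => by simpa using h.shift (-k), fun h => h.shift k⟩

lemma measurableSet_memL1 : MeasurableSet {y : ℤ → E | MemL1 y} := by
  have : {y : ℤ → E | MemL1 y} = {y | ∑' j, ‖y j‖ₑ ≠ ∞} := by
    ext y
    simp only [mem_ofPred_eq, MemL1]
    exact (ENNReal.tsum_coe_ne_top_iff_summable_coe (f := fun j => ‖y j‖₊)).symm
  rw [this]
  exact (Measurable.tsum fun j => (measurable_pi_apply j).enorm)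
    (measurableSet_singleton ∞).compl

/-- Shift-invariant functionals on `ℓ¹` that are Lipschitz with constant `L`. -/
structure IsInvariantLipschitz (Φ : (ℤ → E) → ℝ) (L : ℝ) : Prop where
  nonneg : 0 ≤ L
  lipschitz : ∀ x y : ℤ → E, MemL1 x → MemL1 y → |Φ x - Φ y| ≤ L * ∑' j : ℤ, ‖x j - y j‖
  shift : ∀ x : ℤ → E, MemL1 x → ∀ k : ℤ, Φ (fun j => x (j + k)) = Φ x

/-- An `ℓ¹`-Lipschitz functional need not be continuous for coordinatewise convergence. On sequences
supported in one finite set the `ℓ¹` distance is a finite sum, and continuity is restored. -/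
lemma IsInvariantLipschitz.continuous_comp {Φ : (ℤ → E) → ℝ} {L : ℝ}
    (hΦ : IsInvariantLipschitz Φ L) {T : Type*} [TopologicalSpace T] (S : Finset ℤ)
    {g : T → ℤ → E} (hg : ∀ i, Continuous fun t => g t i) (h0 : ∀ t, ∀ i ∉ S, g t i = 0) :
    Continuous fun t => Φ (g t) := by
  rw [continuous_iff_continuousAt]
  intro t
  rw [ContinuousAt, tendsto_iff_dist_tendsto_zero]
  have hlim : Tendsto (fun t' => L * ∑ i ∈ S, ‖g t' i - g t i‖) (𝓝 t) (𝓝 0) := by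
    have : Continuous fun t' => L * ∑ i ∈ S, ‖g t' i - g t i‖ := by fun_prop
    simpa using this.tendsto t
  refine squeeze_zero (fun _ => dist_nonneg) (fun t' => ?_) hlim
  rw [Real.dist_eq]
  refine (hΦ.lipschitz _ _ (memL1_of_finset S (h0 t')) (memL1_of_finset S (h0 t))).trans_eq ?_
  rw [tsum_eq_sum fun i hi => by rw [h0 t' i hi, h0 t i hi, sub_zero, norm_zero]]

lemma IsInvariantLipschitz.continuous_trunc {Φ : (ℤ → E) → ℝ} {L : ℝ}
    (hΦ : IsInvariantLipschitz Φ L) (m : ℕ) (c : ℝ) :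
    Continuous fun y : ℤ → E => Φ (trunc m fun i => c • y i) := by
  refine hΦ.continuous_comp (Finset.Icc (-(m : ℤ)) m) (fun i => ?_) fun t i hi => if_neg hi
  by_cases hi : i ∈ Finset.Icc (-(m : ℤ)) m
  · simp only [trunc, if_pos hi]; fun_prop
  · simp only [trunc, if_neg hi]; fun_prop

lemma IsInvariantLipschitz.tendsto_trunc {Φ : (ℤ → E) → ℝ} {L : ℝ}
    (hΦ : IsInvariantLipschitz Φ L) {y : ℤ → E} (hy : MemL1 y) :
    Tendsto (fun m => Φ (trunc m y)) atTop (𝓝 (Φ y)) := by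
  rw [tendsto_iff_dist_tendsto_zero]
  have h1 : Tendsto (fun m => ∑' j, ‖trunc m y j - y j‖) atTop (𝓝 (∑' _j : ℤ, (0 : ℝ))) := by
    refine tendsto_tsum_of_dominated_convergence hy (fun j => ?_)
      (Eventually.of_forall fun m j => ?_)
    · refine tendsto_const_nhds.congr' ?_
      filter_upwards [eventually_ge_atTop j.natAbs] with m hm
      rw [trunc, if_pos (by rw [Finset.mem_Icc]; omega), sub_self, norm_zero]
    · by_cases hj : j ∈ Finset.Icc (-(m : ℤ)) m
      · rw [trunc, if_pos hj]; simp
      · rw [trunc, if_neg hj]; simp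
  rw [tsum_zero] at h1
  refine squeeze_zero (fun _ => dist_nonneg) (fun m => ?_) (by simpa using h1.const_mul L)
  exact hΦ.lipschitz _ _ (memL1_trunc m y) hy

/-- On `ℓ¹`, `Φ` is the pointwise limit of its values at truncations, which are continuous functions
of the path. Nothing is known of `Φ` elsewhere, hence the intersection with `ℓ¹`. -/
lemma IsInvariantLipschitz.measurableSet_lt {Φ : (ℤ → E) → ℝ} {L : ℝ}
    (hΦ : IsInvariantLipschitz Φ L) (c : ℝ) : MeasurableSet {y | MemL1 y ∧ c < Φ y} := by
  classical
  have hm : Measurable ({y : ℤ → E | MemL1 y}.indicator Φ) := by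
    refine measurable_of_tendsto_metrizable (f := fun m : ℕ =>
      {y : ℤ → E | MemL1 y}.indicator fun y => Φ (trunc m y)) (fun m => ?_) ?_
    · refine Measurable.indicator ?_ measurableSet_memL1
      simpa using (hΦ.continuous_trunc m 1).measurable
    · rw [tendsto_pi_nhds]
      intro y
      by_cases hy : y ∈ {y : ℤ → E | MemL1 y}
      · simp only [indicator_of_mem hy]
        exact hΦ.tendsto_trunc hy
      · simp only [indicator_of_notMem hy]
        exact tendsto_const_nhds
  have : {y | MemL1 y ∧ c < Φ y} =
      {y | MemL1 y} ∩ {y | c < {y : ℤ → E | MemL1 y}.indicator Φ y} := by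
    ext y
    refine and_congr_right fun hy => ?_
    show _ ↔ c < {y : ℤ → E | MemL1 y}.indicator Φ y
    rw [indicator_of_mem (by exact hy)]
  rw [this]
  exact measurableSet_memL1.inter (hm measurableSet_Ioi)

lemma memL1_block (R : ℕ) (c : ℝ) (ω : Ω) : MemL1 (block X R c ω) :=
  memL1_of_finset (Finset.Icc 1 (R : ℤ)) fun i hi => by
    rw [block, if_neg (by simpa using hi)]

/-- The sum of the small terms in a block. -/
def smallSum (X : ℤ → Ω → E) (R : ℕ) (c : ℝ) (ω : Ω) : ℝ :=
  ∑ j ∈ Finset.Icc (1 : ℤ) R, {a : E | ‖a‖ ≤ c}.indicator (fun a => ‖a‖) (X j ω)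

lemma smallSum_eq (X : ℤ → Ω → E) (R : ℕ) (c : ℝ) (ω : Ω) :
    smallSum X R c ω = ∑ j ∈ Finset.Icc (1 : ℤ) R, if ‖X j ω‖ ≤ c then ‖X j ω‖ else 0 := by
  simp only [smallSum, indicator_apply, mem_ofPred_eq]

/-- On the complement of the anticlustering event, the block differs from the window around `j`
by at most the contribution of the small terms. -/
lemma tsum_block_sub_le {c b : ℝ} (hc : 0 < c) (m R : ℕ) {j : ℤ} (h1 : m < j) (h2 : j + m ≤ R)
    {ω : Ω} (hf : ∀ i, (m : ℤ) ≤ |i - j| → |i - j| ≤ R → ‖X i ω‖ ≤ b) :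
    ∑' i, ‖block X R c ω i - trunc m (fun i => c⁻¹ • X (i + j) ω) (i - j)‖ ≤
      c⁻¹ * smallSum X R b ω := by
  rw [tsum_eq_sum (s := Finset.Icc (1 : ℤ) R), smallSum_eq, Finset.mul_sum]
  · refine Finset.sum_le_sum fun i hi => ?_
    rw [Finset.mem_Icc] at hi
    rw [block, if_pos hi]
    by_cases him : i - j ∈ Finset.Icc (-(m : ℤ)) m
    · rw [trunc, if_pos him]
      simp only [sub_add_cancel, sub_self, norm_zero]
      split_ifs <;> positivity
    · rw [trunc, if_neg him, sub_zero, norm_smul, norm_inv, Real.norm_of_nonneg hc.le]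
      rw [Finset.mem_Icc, ← abs_le] at him
      rw [if_pos (hf i (by omega) (abs_le.2 ⟨by omega, by omega⟩))]
  · intro i hi
    rw [Finset.mem_Icc] at hi
    rw [block, if_neg hi, trunc, if_neg, sub_zero, norm_zero]
    rw [Finset.mem_Icc]; omega

/-- A continuous minorant of `s ↦ s 1{s ≤ δ}`. -/
def softSmall (δ s : ℝ) : ℝ := max 0 (min s (δ - s))

lemma softSmall_le {δ s : ℝ} (hs : 0 ≤ s) : softSmall δ s ≤ if s ≤ δ then s else 0 := by
  unfold softSmall
  split_ifs with h
  · exact max_le hs (min_le_left _ _)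
  · exact max_le le_rfl ((min_le_right _ _).trans (by linarith))

lemma softSmall_of_le {δ s : ℝ} (hs : 0 ≤ s) (h : s ≤ δ / 2) : softSmall δ s = s := by
  unfold softSmall
  rw [min_eq_left (by linarith), max_eq_right hs]

lemma sum_softSmall_le {c δ : ℝ} (hc : 0 < c) (m R : ℕ) {j : ℤ} (h1 : m < j) (h2 : j + m ≤ R)
    (ω : Ω) : c * ∑ i ∈ Finset.Icc (-(m : ℤ)) m, softSmall δ ‖c⁻¹ • X (i + j) ω‖ ≤
      smallSum X R (δ * c) ω := by
  rw [smallSum_eq, Finset.mul_sum]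
  calc _ ≤ ∑ i ∈ Finset.Icc (-(m : ℤ)) m,
        if ‖X (i + j) ω‖ ≤ δ * c then ‖X (i + j) ω‖ else 0 := by
        refine Finset.sum_le_sum fun i _ => ?_
        have h := softSmall_le (δ := δ) (norm_nonneg (c⁻¹ • X (i + j) ω))
        rw [norm_smul, norm_inv, Real.norm_of_nonneg hc.le] at h ⊢
        refine (mul_le_mul_of_nonneg_left h hc.le).trans_eq ?_
        have hiff : c⁻¹ * ‖X (i + j) ω‖ ≤ δ ↔ ‖X (i + j) ω‖ ≤ δ * c := by
          rw [inv_mul_le_iff₀ hc, mul_comm c δ]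
        by_cases hle : ‖X (i + j) ω‖ ≤ δ * c
        · rw [if_pos hle, if_pos (hiff.2 hle), mul_inv_cancel_left₀ hc.ne']
        · rw [if_neg hle, if_neg (mt hiff.1 hle), mul_zero]
    _ = ∑ l ∈ (Finset.Icc (-(m : ℤ)) m).image (· + j),
          if ‖X l ω‖ ≤ δ * c then ‖X l ω‖ else 0 := by
        rw [Finset.sum_image (by simp)]
    _ ≤ _ := by
        refine Finset.sum_le_sum_of_subset_of_nonneg (fun l hl => ?_) fun i _ _ => ?_
        · obtain ⟨i, hi, rfl⟩ := Finset.mem_image.1 hl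
          rw [Finset.mem_Icc] at hi ⊢
          omega
        · split_ifs <;> positivity

/-! ### Limits of block probabilities -/

lemma isOpen_pastBelow (m : ℕ) : IsOpen {y : ℤ → E | ∀ i ∈ Finset.Ico (-(m : ℤ)) 0, ‖y i‖ < 1} := by
  have : {y : ℤ → E | ∀ i ∈ Finset.Ico (-(m : ℤ)) 0, ‖y i‖ < 1} =
      ⋂ i ∈ Finset.Ico (-(m : ℤ)) 0, {y | ‖y i‖ < 1} := by ext; simp
  rw [this]
  exact isOpen_biInter_finset fun i _ => isOpen_lt (continuous_apply i).norm continuous_const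

/-- Passing to the limit `m → ∞` in `block_bound` under the anticlustering condition. -/
lemma le_of_block_bound (hDH : ConditionDH P X r u) {ε δ : ℝ} (hε : 0 < ε) (hδ : 0 < δ)
    {N : Set Ω'} {A : ℕ → Set Ω'} (hN : ∀ ω ∈ N, ∀ᶠ m in atTop, ω ∈ A m) {c b : ℝ≥0∞}
    (hc : c ≠ ∞)
    (h : ∀ m, c * P' (A m) ≤ c * limsup (fun n =>
      ProbabilityTheory.cond P {ω | u n * ε < ‖X 0 ω‖} (farExceed X m (r n) (u n * δ))) atTop + b) :
    c * P' N ≤ b := by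
  have hd : Tendsto (fun m : ℕ => limsup (fun n =>
      ProbabilityTheory.cond P {ω | u n * ε < ‖X 0 ω‖} (farExceed X m (r n) (u n * δ))) atTop)
      atTop (𝓝 0) := hDH δ ε hδ hε
  have hlim := (ENNReal.Tendsto.const_mul hd (Or.inr hc)).add_const b
  rw [mul_zero, zero_add] at hlim
  calc c * P' N ≤ c * liminf (fun m => P' (A m)) atTop := by
        gcongr; exact measure_le_liminf_of_eventually_mem hN
    _ = liminf (fun m => c * P' (A m)) atTop :=
        (ENNReal.liminf_const_mul_of_ne_top hc).symm
    _ ≤ liminf (fun m => c * limsup (fun n =>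
      ProbabilityTheory.cond P {ω | u n * ε < ‖X 0 ω‖}
        (farExceed X m (r n) (u n * δ))) atTop + b) atTop :=
        liminf_le_liminf (Eventually.of_forall h)
    _ = b := hlim.liminf_eq

/-- If a path tends to zero without being summable, its terms below any `δ` already sum to more than
`1`. Blocks resembling such paths have small-term sums above `u n`, and `ANSJB` makes these
negligible as `δ → 0`. This rules out paths anchored at `0` by their first exceedance; time change
extends the conclusion to all paths. -/
lemma IsTailProcess.ae_memL1 (hXm : ∀ j, Measurable (X j)) (hYm : ∀ j, Measurable (Y j))
    (hX : IsStationary P X) (hRV : IsRegularlyVarying P X α) (hY : IsTailProcess P X P' Y)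
    (hr : Tendsto r atTop atTop) (hu : Tendsto u atTop atTop) (hDH : ConditionDH P X r u)
    (hAN : ConditionANSJB P X r u) :
    ∀ᵐ ω ∂P', MemL1 (fun j => Y j ω) := by
  have hzero := hY.tendsto_zero hXm hYm hRV hr hu hDH
  have hone := hY.ae_one_lt hXm hYm hRV
  have hne : ∀ᵐ ω ∂P', ∀ i, ‖Y i ω‖ ≠ 1 := ae_all_iff.2 fun i => by
    rw [ae_iff]; simpa using hY.measure_norm_eq hXm hYm hRV i one_ne_zero
  set N : Set Ω' := {ω | ¬ MemL1 (fun j => Y j ω) ∧ Tendsto (fun j => Y j ω) cofinite (𝓝 0) ∧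
    ∀ i < 0, ‖Y i ω‖ < 1} with hNdef
  have hN : P' N = 0 := by
    refine measure_zero_of_le_tendsto (hAN 1 one_pos) ?_
    filter_upwards [self_mem_nhdsWithin] with δ hδ
    have hδ0 : 0 < δ := hδ
    set W : ℕ → Set (ℤ → E) := fun m => {y | ∀ i ∈ Finset.Ico (-(m : ℤ)) 0, ‖y i‖ < 1} ∩
      {y | 1 < ∑ i ∈ Finset.Icc (-(m : ℤ)) m, softSmall δ ‖y i‖}
    have hWo : ∀ m, IsOpen (W m) := fun m => by
      refine (isOpen_pastBelow m).inter (isOpen_lt continuous_const ?_)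
      unfold softSmall
      fun_prop
    have hWdep : ∀ m : ℕ, ∀ x y : ℤ → E, (∀ i ∈ Finset.Icc (-(m : ℤ)) m, x i = y i) →
        x ∈ W m → y ∈ W m := by
      rintro m x y hxy ⟨h1, h2⟩
      refine ⟨fun i hi => ?_, ?_⟩
      · rw [← hxy i (by rw [Finset.mem_Icc]; rw [Finset.mem_Ico] at hi; omega)]
        exact h1 i hi
      · show 1 < ∑ i ∈ Finset.Icc (-(m : ℤ)) m, softSmall δ ‖y i‖
        refine lt_of_lt_of_eq h2 (Finset.sum_congr rfl fun i hi => ?_)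
        rw [hxy i hi]
    -- Both levels of the block bound are `1`, independently of the truncation `δ`: the window alone
    -- makes the small-term sum large, so the absence of far exceedances is not used here.
    have hbound := fun m => block_bound hXm hYm hX hRV hY hr hu one_pos le_rfl m (hWo m) (hWdep m)
      (fun y hy i h1 h2 => (hy.1 i (Finset.mem_Ico.2 ⟨h1, h2⟩)).le)
      (fun n => {ω | 1 * u n < smallSum X (r n) (δ * u n) ω}) (by
        filter_upwards [hu.eventually_gt_atTop 0] with n hun j h1 h2 ω _ hω _
        have hs := sum_softSmall_le (X := X) (δ := δ) hun m (r n) h1 h2 ω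
        refine lt_of_lt_of_le ?_ hs
        have h3 : 1 < ∑ i ∈ Finset.Icc (-(m : ℤ)) m, softSmall δ ‖(1 * u n)⁻¹ • X (i + j) ω‖ := hω.2
        rw [one_mul] at h3
        rw [one_mul]
        exact lt_mul_of_one_lt_right hun h3)
    have h := le_of_block_bound (N := N) hDH one_pos one_pos
      (A := fun m => {ω | (fun j => Y j ω) ∈ W m}) ?_ ENNReal.ofReal_ne_top hbound
    · rw [Real.one_rpow, ENNReal.ofReal_one, one_mul] at h
      exact h.trans liminf_le_limsup
    · rintro ω ⟨h1, h2, h3⟩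
      -- Along a path tending to zero, `softSmall δ` agrees with the norm except at finitely many
      -- indices.
      have hnot : ¬ Summable fun i => softSmall δ ‖Y i ω‖ := by
        intro hs
        refine h1 ((summable_congr_cofinite ?_).1 hs)
        have := (tendsto_norm_zero.comp h2).eventually_lt_const (half_pos hδ0)
        filter_upwards [this] with i hi
        exact softSmall_of_le (norm_nonneg _) (le_of_lt hi)
      have hnn : ∀ i, 0 ≤ softSmall δ ‖Y i ω‖ := fun i => le_max_left _ _
      have hex : ∃ S : Finset ℤ, 1 < ∑ i ∈ S, softSmall δ ‖Y i ω‖ := by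
        by_contra hcon
        push Not at hcon
        exact hnot (summable_of_sum_le hnn hcon)
      obtain ⟨S, hS⟩ := hex
      obtain ⟨k, hk⟩ := exists_Icc_superset S
      filter_upwards [eventually_ge_atTop k] with m hm
      refine ⟨fun i hi => h3 i (Finset.mem_Ico.1 hi).2, lt_of_lt_of_le hS ?_⟩
      refine Finset.sum_le_sum_of_subset_of_nonneg (hk.trans (Finset.Icc_subset_Icc ?_ ?_))
        fun i _ _ => hnn i <;> omega
  have hanch := isAnchor_firstExceedAt hone hzero
  have hfin := hanch.measure_eq_zero hXm hYm hX hRV hY (G := {y | MemL1 y}ᶜ)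
    measurableSet_memL1.compl (fun y k => not_congr (memL1_shift_iff (x := y) (-k))) ?_
  · rw [ae_iff]; exact hfin
  · refine measure_mono_null_ae ?_ hN
    filter_upwards [hzero, hne] with ω h1 h2 h3
    exact ⟨h3.1, h1, fun i hi => lt_of_le_of_ne (h3.2.2 i hi) (h2 i)⟩

/-- The event that a block contains an exceedance of the level `c`. -/
def blockExceed (X : ℤ → Ω → E) (R : ℕ) (c : ℝ) : Set Ω :=
  {ω | ∃ j : ℤ, 1 ≤ j ∧ j ≤ R ∧ c < ‖X j ω‖}

/-- The strict inequality `Φ > 0` is open on windows, and by the Lipschitz property it survives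
passing from the window to the whole block when the small terms have a small sum. Hence only a lower
bound results. -/
lemma le_liminf_block (hXm : ∀ j, Measurable (X j)) (hYm : ∀ j, Measurable (Y j))
    (hX : IsStationary P X) (hRV : IsRegularlyVarying P X α) (hY : IsTailProcess P X P' Y)
    (hr : Tendsto r atTop atTop) (hu : Tendsto u atTop atTop) (hDH : ConditionDH P X r u)
    (hAN : ConditionANSJB P X r u) {Φ : (ℤ → E) → ℝ} {L : ℝ} (hΦ : IsInvariantLipschitz Φ L)
    {ε : ℝ} (hε : 0 < ε) :
    ENNReal.ofReal (ε ^ (-α)) *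
        P' {ω | 0 < Φ (fun j => ε • Y j ω) ∧ ∀ i < 0, ‖Y i ω‖ ≤ 1} ≤
      liminf (fun n => P ({ω | 0 < Φ (block X (r n) (u n) ω)} ∩ blockExceed X (r n) (ε * u n)) /
        (r n * P {ω | u n < ‖X 0 ω‖})) atTop := by
  set c := ENNReal.ofReal (ε ^ (-α))
  have hc : c ≠ ∞ := ENNReal.ofReal_ne_top
  set lim := liminf (fun n => P ({ω | 0 < Φ (block X (r n) (u n) ω)} ∩
    blockExceed X (r n) (ε * u n)) / (r n * P {ω | u n < ‖X 0 ω‖})) atTop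
  have hl1 := hY.ae_memL1 hXm hYm hX hRV hr hu hDH hAN
  have hne : ∀ᵐ ω ∂P', ∀ i, ‖Y i ω‖ ≠ 1 := ae_all_iff.2 fun i => by
    rw [ae_iff]; simpa using hY.measure_norm_eq hXm hYm hRV i one_ne_zero
  -- The margin `L * η` absorbs the Lipschitz error of replacing the block by its window when the
  -- small terms sum to at most `η * u n`. Strict inequalities for the past make the window event
  -- open.
  set N : ℝ → Set Ω' := fun η => {ω | MemL1 (fun j => Y j ω) ∧
    L * η < Φ (fun j => ε • Y j ω) ∧ ∀ i < 0, ‖Y i ω‖ < 1}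
  have hN : ∀ η, 0 < η → c * P' (N η) ≤ lim := by
    intro η hη
    have hδ : ∀ δ, 0 < δ → δ ≤ ε → c * P' (N η) ≤
        limsup (fun n => P {ω | η * u n < smallSum X (r n) (δ * u n) ω} /
          (r n * P {ω | u n < ‖X 0 ω‖})) atTop + lim := by
      intro δ hδ0 hδ
      set W : ℕ → Set (ℤ → E) := fun m => {y | ∀ i ∈ Finset.Ico (-(m : ℤ)) 0, ‖y i‖ < 1} ∩
        {y | L * η < Φ (trunc m fun i => ε • y i)}
      have hWo : ∀ m, IsOpen (W m) := fun m =>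
        (isOpen_pastBelow m).inter (isOpen_lt continuous_const (hΦ.continuous_trunc m ε))
      have hWdep : ∀ m : ℕ, ∀ x y : ℤ → E, (∀ i ∈ Finset.Icc (-(m : ℤ)) m, x i = y i) →
          x ∈ W m → y ∈ W m := by
        rintro m x y hxy ⟨h1, h2⟩
        refine ⟨fun i hi => ?_, ?_⟩
        · rw [← hxy i (by rw [Finset.mem_Icc]; rw [Finset.mem_Ico] at hi; omega)]
          exact h1 i hi
        · have : (trunc m fun i => ε • y i) = trunc m fun i => ε • x i := by
            ext i
            by_cases hi : i ∈ Finset.Icc (-(m : ℤ)) m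
            · rw [trunc, trunc, if_pos hi, if_pos hi, hxy i hi]
            · rw [trunc, trunc, if_neg hi, if_neg hi]
          show L * η < Φ _
          rw [this]
          exact h2
      set S : ℕ → Set Ω := fun n => {ω | η * u n < smallSum X (r n) (δ * u n) ω}
      set G : ℕ → Set Ω := fun n => {ω | 0 < Φ (block X (r n) (u n) ω)} ∩
        blockExceed X (r n) (ε * u n)
      have hbound := fun m => block_bound hXm hYm hX hRV hY hr hu hε hδ m (hWo m) (hWdep m)
        (fun y hy i h1 h2 => (hy.1 i (Finset.mem_Ico.2 ⟨h1, h2⟩)).le)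
        (fun n => S n ∪ G n) (by
          filter_upwards [hu.eventually_gt_atTop 0] with n hun j h1 h2 ω hj hω hf
          by_cases hS : η * u n < smallSum X (r n) (δ * u n) ω
          · exact Or.inl hS
          · refine Or.inr ⟨?_, j, by omega, by omega, hj⟩
            have h3 : L * η < Φ (trunc m fun i => ε • (ε * u n)⁻¹ • X (i + j) ω) := hω.2
            have e1 : (fun i => ε • (ε * u n)⁻¹ • X (i + j) ω) =
                fun i => (u n)⁻¹ • X (i + j) ω := by
              ext i
              rw [smul_smul, mul_inv, mul_inv_cancel_left₀ hε.ne']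
            -- Shift invariance moves the window from the origin back to its place around `j`, where
            -- it can be compared with the block.
            rw [e1, ← hΦ.shift _ (memL1_trunc _ _) (-j)] at h3
            have h4 := hΦ.lipschitz _ _ (memL1_block (X := X) (r n) (u n) ω)
              ((memL1_trunc m fun i => (u n)⁻¹ • X (i + j) ω).shift (-j))
            have h5 := tsum_block_sub_le hun m (r n) h1 h2 hf
            have h6 : (u n)⁻¹ * smallSum X (r n) (δ * u n) ω ≤ η := by
              rw [inv_mul_le_iff₀ hun]; linarith
            have h7 := mul_le_mul_of_nonneg_left (h5.trans h6) hΦ.nonneg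
            have h8 := (abs_le.1 (h4.trans h7)).1
            show 0 < Φ _
            linarith)
      have h := le_of_block_bound (N := N η) hDH hε hδ0
        (A := fun m => {ω | (fun j => Y j ω) ∈ W m}) ?_ hc hbound
      · refine h.trans (le_trans (liminf_le_liminf (Eventually.of_forall fun n => ?_))
          (ennreal_liminf_add_le _ _))
        rw [← ENNReal.add_div]
        exact ENNReal.div_le_div_right (measure_union_le _ _) _
      · rintro ω ⟨h1, h2, h3⟩
        filter_upwards [(hΦ.tendsto_trunc (h1.smul ε)).eventually_const_lt h2] with m hm
        exact ⟨fun i hi => h3 i (Finset.mem_Ico.1 hi).2, hm⟩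
    have hlim := (hAN η hη).add_const lim
    rw [zero_add] at hlim
    refine ge_of_tendsto hlim ?_
    -- The bound holds for every level `δ ≤ ε`; letting `δ → 0` removes the small-sum term by
    -- `ANSJB`.
    filter_upwards [Ioc_mem_nhdsGT hε] with δ hδ'
    exact hδ δ hδ'.1 hδ'.2
  calc c * P' {ω | 0 < Φ (fun j => ε • Y j ω) ∧ ∀ i < 0, ‖Y i ω‖ ≤ 1}
      ≤ c * P' {ω | MemL1 (fun j => Y j ω) ∧ 0 < Φ (fun j => ε • Y j ω) ∧
          ∀ i < 0, ‖Y i ω‖ < 1} := by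
        refine mul_le_mul_right (measure_mono_ae ?_) _
        filter_upwards [hl1, hne] with ω h1 h2 h3
        exact ⟨h1, h3.1, fun i hi => lt_of_le_of_ne (h3.2 i hi) (h2 i)⟩
    _ ≤ c * liminf (fun q : ℕ => P' (N (1 / ((q : ℝ) + 1)))) atTop := by
        gcongr
        refine measure_le_liminf_of_eventually_mem ?_
        rintro ω ⟨h1, h2, h3⟩
        have := (tendsto_one_div_add_atTop_nhds_zero_nat (𝕜 := ℝ)).const_mul L
        rw [mul_zero] at this
        filter_upwards [this.eventually_lt_const h2] with q hq
        exact ⟨h1, hq, h3⟩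
    _ = liminf (fun q : ℕ => c * P' (N (1 / ((q : ℝ) + 1)))) atTop :=
        (ENNReal.liminf_const_mul_of_ne_top hc).symm
    _ ≤ liminf (fun _ : ℕ => lim) atTop :=
        liminf_le_liminf (Eventually.of_forall fun q => hN _ (by positivity))
    _ = lim := liminf_const _

/-- A union bound over the first exceedance, keeping only the last `m` steps of its past. The past
condition is closed, so the portmanteau inequality bounds it from above; then `m → ∞`. -/
lemma limsup_blockExceed_le (hXm : ∀ j, Measurable (X j)) (hYm : ∀ j, Measurable (Y j))
    (hX : IsStationary P X) (hRV : IsRegularlyVarying P X α) (hY : IsTailProcess P X P' Y)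
    (hr : Tendsto r atTop atTop) (hu : Tendsto u atTop atTop) {ε : ℝ} (hε : 0 < ε) :
    limsup (fun n => P (blockExceed X (r n) (ε * u n)) / (r n * P {ω | u n < ‖X 0 ω‖})) atTop ≤
      ENNReal.ofReal (ε ^ (-α)) * P' {ω | ∀ i < 0, ‖Y i ω‖ ≤ 1} := by
  set c := ENNReal.ofReal (ε ^ (-α))
  have hc : c ≠ ∞ := ENNReal.ofReal_ne_top
  set q : ℕ → ℝ≥0∞ := fun n => P {ω | ε * u n < ‖X 0 ω‖}
  set p : ℕ → ℝ≥0∞ := fun n => P {ω | u n < ‖X 0 ω‖}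
  have hq0 : ∀ n, q n ≠ 0 := fun n => (hRV.tail_pos _).ne'
  have hqp : Tendsto (fun n => q n / p n) atTop (𝓝 c) := hRV.tail_seq hu hε
  set V : ℕ → Set (ℤ → E) := fun m => {y | ∀ i ∈ Finset.Ico (-(m : ℤ)) 0, ‖y i‖ ≤ 1} with hVdef
  have hV : ∀ m, IsClosed (V m) := fun m => by
    have : V m = ⋂ i ∈ Finset.Ico (-(m : ℤ)) 0, {y | ‖y i‖ ≤ 1} := by ext; simp [V]
    rw [this]
    exact isClosed_biInter fun i _ => isClosed_le (continuous_apply i).norm continuous_const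
  have hm : ∀ m, limsup (fun n => P (blockExceed X (r n) (ε * u n)) / (r n * p n)) atTop ≤
      c * P' {ω | (fun j => Y j ω) ∈ V m} := by
    intro m
    set w : ℕ → ℝ≥0∞ := fun n => ProbabilityTheory.cond P {ω | ε * u n < ‖X 0 ω‖}
      {ω | (fun i => (ε * u n)⁻¹ • X i ω) ∈ V m}
    have hw1 : limsup w atTop ≤ P' {ω | (fun j => Y j ω) ∈ V m} :=
      (limsup_comp_le_limsup (hu.const_mul_atTop hε) _).trans
        (hY.limsup_closed_le hXm hYm hRV (hV m) (S := Finset.Ico (-(m : ℤ)) 0)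
          (fun x y hxy hx i hi => by rw [← hxy i hi]; exact hx i hi))
    have hineq : ∀ᶠ n in atTop, P (blockExceed X (r n) (ε * u n)) / (r n * p n) ≤
        (m : ℝ≥0∞) / r n * (q n / p n) + q n / p n * w n := by
      filter_upwards [hr.eventually_ge_atTop 1, hu.eventually_gt_atTop 0] with n hrn hun
      have hεu : 0 < ε * u n := mul_pos hε hun
      have hr0 : (r n : ℝ≥0∞) ≠ 0 := by simp; omega
      have hqw : q n * w n = P ({ω | ε * u n < ‖X 0 ω‖} ∩
          {ω | (fun i => (ε * u n)⁻¹ • X i ω) ∈ V m}) := by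
        have := ProbabilityTheory.cond_apply (μ := P) (s := {ω | ε * u n < ‖X 0 ω‖})
          (measurableSet_lt measurable_const (hXm 0).norm)
          {ω | (fun i => (ε * u n)⁻¹ • X i ω) ∈ V m}
        change q n * ProbabilityTheory.cond P {ω | ε * u n < ‖X 0 ω‖} _ = _
        rw [this, ← mul_assoc, ENNReal.mul_inv_cancel (hq0 n) (measure_ne_top _ _), one_mul]
      have hmeas1 : MeasurableSet {y : ℤ → E | ε * u n < ‖y 0‖} :=
        measurableSet_lt measurable_const (measurable_pi_apply 0).norm
      have hmeas2 : MeasurableSet ({y : ℤ → E | ε * u n < ‖y 0‖} ∩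
          {y | (fun i => (ε * u n)⁻¹ • y i) ∈ V m}) :=
        hmeas1.inter ((hV m).preimage (by fun_prop :
          Continuous fun (y : ℤ → E) i => (ε * u n)⁻¹ • y i)).measurableSet
      -- The first `m` indices do not have `m` predecessors in the block. They are bounded crudely
      -- by `q n`, at a total relative cost of order `m / r n`.
      have hj : ∀ j ∈ Finset.Icc (1 : ℤ) (r n), P (firstExceed X (ε * u n) j) ≤
          (if j ≤ m then q n else 0) + q n * w n := by
        intro j hj
        rw [Finset.mem_Icc] at hj
        by_cases hjm : j ≤ m
        · rw [if_pos hjm]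
          refine le_add_right ?_
          have e := hX.measure_eq hXm j hmeas1
          change _ = q n at e
          rw [← e]
          refine measure_mono fun ω hω => ?_
          show ε * u n < ‖X (0 + j) ω‖
          rw [zero_add]; exact hω.1
        · rw [if_neg hjm, zero_add, hqw]
          have e := hX.measure_eq hXm j hmeas2
          refine le_trans (measure_mono fun ω hω => ?_) e.le
          refine ⟨?_, fun i hi => ?_⟩
          · show ε * u n < ‖X (0 + j) ω‖
            rw [zero_add]; exact hω.1
          · rw [Finset.mem_Ico] at hi
            have := hω.2 (i + j) (by omega) (by omega)
            rw [norm_smul, norm_inv, Real.norm_of_nonneg hεu.le, inv_mul_le_iff₀ hεu, mul_one]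
            exact this
      have htot : P (blockExceed X (r n) (ε * u n)) ≤ m * q n + r n * (q n * w n) := by
        calc P (blockExceed X (r n) (ε * u n))
            ≤ P (⋃ j ∈ Finset.Icc (1 : ℤ) (r n), firstExceed X (ε * u n) j) := by
              refine measure_mono fun ω hω => ?_
              obtain ⟨j, hj, h⟩ := exists_firstExceed hω
              exact mem_iUnion₂.2 ⟨j, hj, h⟩
          _ ≤ ∑ j ∈ Finset.Icc (1 : ℤ) (r n), P (firstExceed X (ε * u n) j) :=
              measure_biUnion_finset_le _ _
          _ ≤ ∑ j ∈ Finset.Icc (1 : ℤ) (r n), ((if j ≤ m then q n else 0) + q n * w n) :=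
              Finset.sum_le_sum hj
          _ ≤ _ := by
              rw [Finset.sum_add_distrib, Finset.sum_const, Int.card_Icc, nsmul_eq_mul,
                ← Finset.sum_filter, Finset.sum_const, nsmul_eq_mul]
              gcongr
              · calc _ ≤ (Finset.Icc (1 : ℤ) m).card := by
                      refine Finset.card_le_card fun j hj => ?_
                      rw [Finset.mem_filter, Finset.mem_Icc] at hj
                      exact Finset.mem_Icc.2 ⟨hj.1.1, hj.2⟩
                  _ = m := by simp
              · omega
      have hinv : ((r n : ℝ≥0∞) * p n)⁻¹ = (r n : ℝ≥0∞)⁻¹ * (p n)⁻¹ :=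
        ENNReal.mul_inv (Or.inl hr0) (Or.inl (by simp))
      calc _ ≤ (m * q n + r n * (q n * w n)) / (r n * p n) := ENNReal.div_le_div_right htot _
        _ = (m : ℝ≥0∞) / r n * (q n / p n) +
            (r n : ℝ≥0∞) * (r n : ℝ≥0∞)⁻¹ * (q n / p n * w n) := by
          simp only [div_eq_mul_inv, hinv, add_mul]; ring
        _ = _ := by rw [ENNReal.mul_inv_cancel hr0 (by simp), one_mul]
    have hz : Tendsto (fun n => (m : ℝ≥0∞) / r n * (q n / p n)) atTop (𝓝 0) := by
      have h1 : Tendsto (fun n => (m : ℝ≥0∞) / (r n : ℝ≥0∞)) atTop (𝓝 0) := by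
        have := ENNReal.Tendsto.const_div (a := (m : ℝ≥0∞)) (m := fun n => (r n : ℝ≥0∞)) (b := ∞)
          (f := atTop) (ENNReal.tendsto_nat_nhds_top.comp hr) (Or.inr (by simp))
        simpa using this
      have := ENNReal.Tendsto.mul h1 (Or.inr hc) hqp (Or.inr ENNReal.zero_ne_top)
      rwa [zero_mul] at this
    have hw1' : limsup w atTop ≠ ∞ := (hw1.trans_lt (measure_lt_top _ _)).ne
    have hmul : limsup (fun n => q n / p n * w n) atTop ≤ c * limsup w atTop := by
      have := ENNReal.limsup_mul_le' (f := atTop) (u := fun n => q n / p n) (v := w)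
        (Or.inr hw1') (Or.inl (by rw [hqp.limsup_eq]; exact hc))
      rwa [hqp.limsup_eq] at this
    have hadd := ennreal_limsup_add_le (fun n => (m : ℝ≥0∞) / r n * (q n / p n))
      (fun n => q n / p n * w n)
    rw [hz.limsup_eq, zero_add] at hadd
    exact (limsup_le_limsup hineq).trans (hadd.trans (hmul.trans (mul_le_mul_right hw1 _)))
  have hlim : Tendsto (fun m => c * P' {ω | (fun j => Y j ω) ∈ V m}) atTop
      (𝓝 (c * P' {ω | ∀ i < 0, ‖Y i ω‖ ≤ 1})) := by
    refine ENNReal.Tendsto.const_mul ?_ (Or.inr hc)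
    have hmY : Measurable (fun ω i => Y i ω) := measurable_pi_lambda _ fun l => hYm l
    have e : {ω | ∀ i < 0, ‖Y i ω‖ ≤ 1} = ⋂ m, {ω | (fun j => Y j ω) ∈ V m} := by
      ext ω
      simp only [mem_iInter, mem_ofPred_eq, V, Finset.mem_Ico]
      exact ⟨fun h m i hi => h i hi.2, fun h i hi => h i.natAbs i ⟨by omega, hi⟩⟩
    rw [e]
    refine tendsto_measure_iInter_atTop
      (fun m => (hmY (hV m).measurableSet).nullMeasurableSet) ?_ ⟨0, measure_ne_top _ _⟩
    intro m k hmk ω hω i hi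
    rw [Finset.mem_Ico] at hi
    exact hω i (Finset.mem_Ico.2 ⟨by omega, hi.2⟩)
  exact ge_of_tendsto hlim (Eventually.of_forall hm)

/-! ### The distance to the set `{K > 1}` -/

/-- The `ℓ¹` distance to `{K > 1}`. -/
def exceedEDist (K : (ℤ → E) → ℝ) (x : ℤ → E) : ℝ≥0∞ :=
  ⨅ y ∈ {y : ℤ → E | MemL1 y ∧ 1 < K y}, ∑' j, ‖y j - x j‖ₑ

/-- The `ℓ¹` distance to `{K > 1}`, capped at `1`. -/
def exceedDist (K : (ℤ → E) → ℝ) (x : ℤ → E) : ℝ := (min (exceedEDist K x) 1).toReal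

lemma tsum_enorm_sub {x y : ℤ → E} (hx : MemL1 x) (hy : MemL1 y) :
    ∑' j, ‖x j - y j‖ₑ = ENNReal.ofReal (∑' j, ‖x j - y j‖) := by
  rw [ENNReal.ofReal_tsum_of_nonneg (fun _ => norm_nonneg _) (hx.sub hy)]
  simp only [ofReal_norm]

lemma exceedEDist_le_add (K : (ℤ → E) → ℝ) (x y : ℤ → E) :
    exceedEDist K x ≤ exceedEDist K y + ∑' j, ‖x j - y j‖ₑ := by
  unfold exceedEDist
  rw [ENNReal.iInf_add]
  refine le_iInf fun z => ?_
  rw [ENNReal.iInf_add]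
  refine le_iInf fun hz => (iInf₂_le z hz).trans ?_
  rw [← ENNReal.tsum_add]
  refine ENNReal.tsum_le_tsum fun j => ?_
  calc ‖z j - x j‖ₑ = ‖(z j - y j) - (x j - y j)‖ₑ := by congr 1; abel
    _ ≤ _ := enorm_sub_le

lemma exceedDist_le_add (K : (ℤ → E) → ℝ) {x y : ℤ → E} (hx : MemL1 x) (hy : MemL1 y) :
    exceedDist K x ≤ exceedDist K y + ∑' j, ‖x j - y j‖ := by
  have hnn : 0 ≤ ∑' j, ‖x j - y j‖ := tsum_nonneg fun _ => norm_nonneg _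
  have h : min (exceedEDist K x) 1 ≤
      min (exceedEDist K y) 1 + ENNReal.ofReal (∑' j, ‖x j - y j‖) := by
    rw [← min_add_add_right]
    refine le_min ((min_le_left _ _).trans ?_) ((min_le_right _ _).trans le_self_add)
    rw [← tsum_enorm_sub hx hy]
    exact exceedEDist_le_add K x y
  have hy1 : min (exceedEDist K y) 1 ≠ ∞ := ((min_le_right _ _).trans_lt ENNReal.one_lt_top).ne
  have := ENNReal.toReal_mono (ENNReal.add_ne_top.2 ⟨hy1, ENNReal.ofReal_ne_top⟩) h
  rwa [ENNReal.toReal_add hy1 ENNReal.ofReal_ne_top, ENNReal.toReal_ofReal hnn] at this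

lemma IsLipschitzClusterFunctional.exceedEDist_shift_le {K : (ℤ → E) → ℝ}
    (hK : IsLipschitzClusterFunctional K) (x : ℤ → E) (k : ℤ) :
    exceedEDist K (fun j => x (j + k)) ≤ exceedEDist K x := by
  refine le_iInf₂ fun y hy => ?_
  have hmem : (fun j => y (j + k)) ∈ {y : ℤ → E | MemL1 y ∧ 1 < K y} :=
    ⟨hy.1.shift k, by rw [hK.shift_invariant y hy.1 k]; exact hy.2⟩
  refine (iInf₂_le _ hmem).trans_eq ?_
  exact (Equiv.addRight k).tsum_eq (fun j => ‖y j - x j‖ₑ)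

/-- A distance function is `1`-Lipschitz, and it inherits shift invariance from the set. The cap at
`1` keeps it finite even when `{K > 1}` is empty. -/
lemma IsLipschitzClusterFunctional.isInvariantLipschitz_exceedDist {K : (ℤ → E) → ℝ}
    (hK : IsLipschitzClusterFunctional K) : IsInvariantLipschitz (exceedDist K) 1 where
  nonneg := zero_le_one
  lipschitz x y hx hy := by
    have h1 := exceedDist_le_add K hx hy
    have h2 := exceedDist_le_add K hy hx
    have h3 : ∑' j, ‖y j - x j‖ = ∑' j, ‖x j - y j‖ := tsum_congr fun j => norm_sub_rev _ _
    rw [h3] at h2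
    rw [one_mul, abs_le]
    constructor <;> linarith
  shift x _ k := by
    unfold exceedDist
    congr 2
    refine le_antisymm (hK.exceedEDist_shift_le x k) ?_
    simpa using hK.exceedEDist_shift_le (fun j => x (j + k)) (-k)

lemma IsLipschitzClusterFunctional.isInvariantLipschitz_sub_one {K : (ℤ → E) → ℝ}
    (hK : IsLipschitzClusterFunctional K) :
    ∃ L, IsInvariantLipschitz (fun x => K x - 1) L := by
  obtain ⟨L, hL⟩ := hK.lipschitz
  refine ⟨max L 0, le_max_right _ _, fun x y hx hy => ?_, fun x hx k => ?_⟩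
  · rw [sub_sub_sub_cancel_right]
    refine (hL x y hx hy).trans ?_
    gcongr
    exact le_max_left _ _
  · rw [hK.shift_invariant x hx k]

lemma not_lt_of_exceedDist_pos {K : (ℤ → E) → ℝ} {x : ℤ → E} (hx : MemL1 x)
    (h : 0 < exceedDist K x) : ¬ 1 < K x := by
  intro hK
  have : exceedEDist K x ≤ 0 := (iInf₂_le x ⟨hx, hK⟩).trans_eq (by simp)
  rw [exceedDist, le_antisymm this zero_le] at h
  simp at h

/-- A `{0, 1}`-valued functional that is continuous at `x` and vanishes there vanishes on a whole
`ℓ¹` ball around `x`, which therefore misses `{K > 1}`. -/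
lemma exceedDist_pos_of_continuousAt {K : (ℤ → E) → ℝ} {x : ℤ → E}
    (hc : L1ContinuousAt (exceed K) x) (h : ¬ 1 < K x) : 0 < exceedDist K x := by
  obtain ⟨δ, hδ, hδ'⟩ := hc 1 one_pos
  have hle : ENNReal.ofReal δ ≤ exceedEDist K x := by
    refine le_iInf₂ fun y hy => ?_
    by_contra hlt
    have h1 := hδ' y hy.1 (not_le.1 hlt)
    rw [exceed, indicator_of_mem (by exact hy.2), indicator_of_notMem (by exact h)] at h1
    simp at h1
  refine ENNReal.toReal_pos ?_ ((min_le_right _ _).trans_lt ENNReal.one_lt_top).ne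
  exact (lt_min ((ENNReal.ofReal_pos.2 hδ).trans_le hle) one_pos).ne'

/-! ### Limits in the extended nonnegative reals -/

/-- Lower bounds for two quantities become limits once an upper bound for their sum matches the sum
of the lower bounds: an excess in `b` would force a deficit in `e`. -/
lemma tendsto_of_complement {b e T : ℕ → ℝ≥0∞} {V V' : ℝ≥0∞} (hV' : V' ≠ ∞) (hV : V ≠ ∞)
    (hbe : ∀ n, b n + e n ≤ T n) (hb : V ≤ liminf b atTop) (he : V' ≤ liminf e atTop)
    (hT : limsup T atTop ≤ V + V') : Tendsto b atTop (𝓝 V) := by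
  refine tendsto_of_le_liminf_of_limsup_le hb ?_
  refine ENNReal.le_of_forall_pos_le_add fun η hη _ => ?_
  set ζ : ℝ≥0∞ := ((η / 2 : NNReal) : ℝ≥0∞)
  have hζ : ζ ≠ 0 := by simp [ζ, hη.ne']
  have hζ2 : ζ + ζ = η := by simp only [ζ]; rw [← ENNReal.coe_add, add_halves]
  have h1 : ∀ᶠ n in atTop, V' ≤ e n + ζ := by
    by_cases h0 : V' = 0
    · exact Eventually.of_forall fun n => by rw [h0]; exact zero_le
    · have := eventually_lt_of_lt_liminf ((ENNReal.sub_lt_self hV' h0 hζ).trans_le he)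
      filter_upwards [this] with n hn
      exact tsub_le_iff_right.1 hn.le
  have h2 : ∀ᶠ n in atTop, T n < V + V' + ζ :=
    eventually_lt_of_limsup_lt (hT.trans_lt
      (ENNReal.lt_add_right (ENNReal.add_ne_top.2 ⟨hV, hV'⟩) hζ))
  refine limsup_le_of_le (by isBoundedDefault) ?_
  filter_upwards [h1, h2] with n h3 h4
  rw [← ENNReal.add_le_add_iff_right hV']
  calc b n + V' ≤ b n + (e n + ζ) := by gcongr
    _ = b n + e n + ζ := by ring
    _ ≤ (V + V' + ζ) + ζ := add_le_add_left ((hbe n).trans h4.le) _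
    _ = V + η + V' := by rw [← hζ2]; ring

/-- Each `V k` bounds the liminf of `a` from below and each `V k + C k` bounds its limsup from
above. Finiteness of `B` follows from a single `k` with `C k < 1`. -/
lemma tendsto_of_approx {a : ℕ → ℝ≥0∞} {b c : ℕ → ℕ → ℝ≥0∞} {V C : ℕ → ℝ≥0∞} {B : ℝ≥0∞}
    (hb : ∀ k, Tendsto (b k) atTop (𝓝 (V k))) (hba : ∀ k n, b k n ≤ a n)
    (hab : ∀ k, ∀ᶠ n in atTop, a n ≤ b k n + c k n) (hc : ∀ k, limsup (c k) atTop ≤ C k)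
    (hC : Tendsto C atTop (𝓝 0)) (hV : Tendsto V atTop (𝓝 B)) (hVfin : ∀ k, V k ≠ ∞) :
    Tendsto a atTop (𝓝 B) ∧ B < ∞ := by
  have hlow : B ≤ liminf a atTop := le_of_tendsto hV (Eventually.of_forall fun k => by
    rw [← (hb k).liminf_eq]
    exact liminf_le_liminf (Eventually.of_forall (hba k)))
  have hup : ∀ k, limsup a atTop ≤ V k + C k := fun k => by
    refine (limsup_le_limsup (hab k)).trans ((ennreal_limsup_add_le (b k) (c k)).trans ?_)
    rw [(hb k).limsup_eq]
    gcongr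
    exact hc k
  have hup' : limsup a atTop ≤ B := by
    have := hV.add hC
    rw [add_zero] at this
    exact ge_of_tendsto this (Eventually.of_forall hup)
  refine ⟨tendsto_of_le_liminf_of_limsup_le hlow hup', ?_⟩
  obtain ⟨k, hk⟩ := (hC.eventually_lt_const one_pos).exists
  have hBk : B ≤ V k + C k := hlow.trans (le_trans liminf_le_limsup (hup k))
  exact hBk.trans_lt
    (ENNReal.add_lt_top.2 ⟨(hVfin k).lt_top, hk.trans ENNReal.one_lt_top⟩)

/-! ### The infargmax functional -/

/-- Convergence to zero is essential: otherwise norms strictly below `‖y 0‖` in the past could have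
supremum exactly `‖y 0‖`. -/
lemma infargmax_eq_zero_iff {y : ℤ → E} (hy : Tendsto y cofinite (𝓝 0)) (h0 : y 0 ≠ 0) :
    infargmax y = 0 ↔ y ∈ firstArgmaxAt 0 := by
  have hmono : Monotone (supNormUpTo y) := fun i j hij =>
    iSup_mono fun l => iSup_mono' fun h => ⟨h.trans hij, le_rfl⟩
  have hle : ∀ j, supNormUpTo y j ≤ supNorm y := fun j =>
    iSup_mono fun l => iSup_le fun _ => le_rfl
  set A : Set ℤ := {j | supNormUpTo y j = supNorm y} with hA
  have hcoe : StrictMono (fun j : ℤ => ((j : ℝ) : EReal)) := fun a b h => by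
    simpa using h
  -- `A` is an upward closed set of integers, so its infimum is `0` exactly when it contains `0` but
  -- not `-1`.
  have hinf : infargmax y = 0 ↔ (0 : ℤ) ∈ A ∧ (-1 : ℤ) ∉ A := by
    constructor
    · intro h
      have hlt : ∀ j ∈ A, 0 ≤ j := fun j hj => by
        have : infargmax y ≤ ((j : ℝ) : EReal) := sInf_le ⟨j, hj, rfl⟩
        rw [h] at this
        exact_mod_cast this
      refine ⟨?_, fun h1 => absurd (hlt _ h1) (by norm_num)⟩
      have h1 : infargmax y < (((1 : ℤ) : ℝ) : EReal) := by rw [h]; norm_num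
      obtain ⟨_, ⟨j, hj, rfl⟩, hj1⟩ := sInf_lt_iff.1 h1
      have hj2 : j < 1 := hcoe.lt_iff_lt.1 hj1
      have : j = 0 := le_antisymm (by omega) (hlt j hj)
      exact this ▸ hj
    · rintro ⟨h1, h2⟩
      refine le_antisymm ?_ ?_
      · have : infargmax y ≤ (((0 : ℤ) : ℝ) : EReal) := sInf_le ⟨0, h1, rfl⟩
        simpa using this
      · refine le_sInf ?_
        rintro _ ⟨j, hj, rfl⟩
        have : 0 ≤ j := by
          by_contra hneg
          refine h2 (le_antisymm (hle _) ?_)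
          have hj' : supNormUpTo y j = supNorm y := hj
          rw [← hj']
          exact hmono (by omega)
        simpa using this
  rw [hinf]
  constructor
  · rintro ⟨h1, h2⟩
    have h1' : supNormUpTo y 0 = supNorm y := h1
    have h2' : supNormUpTo y (-1) < supNorm y := lt_of_le_of_ne (hle _) h2
    have hsup : supNorm y ≤ max (supNormUpTo y (-1)) ‖y 0‖ₑ := by
      rw [← h1']
      refine iSup₂_le fun i hi => ?_
      rcases hi.lt_or_eq with h | rfl
      · exact le_max_of_le_left (le_iSup₂_of_le i (by omega) le_rfl)
      · exact le_max_right _ _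
    have hsup' : supNorm y ≤ ‖y 0‖ₑ := by
      rcases le_max_iff.1 hsup with h | h
      · exact absurd h (not_le.2 h2')
      · exact h
    refine ⟨fun i => ?_, fun i hi => ?_⟩
    · exact enorm_le_iff_norm_le.1 ((le_iSup (fun i => ‖y i‖ₑ) i).trans hsup')
    · have hlt : ‖y i‖ₑ < ‖y 0‖ₑ := lt_of_le_of_lt
        (le_iSup₂_of_le (f := fun i (_ : i ≤ -1) => ‖y i‖ₑ) i (by omega) le_rfl)
        (h2'.trans_le hsup')
      exact not_le.1 fun h => hlt.not_ge (enorm_le_iff_norm_le.2 h)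
  · rintro ⟨h1, h2⟩
    have hsup : supNorm y = ‖y 0‖ₑ :=
      le_antisymm (iSup_le fun i => enorm_le_iff_norm_le.2 (h1 i)) (le_iSup (fun i => ‖y i‖ₑ) 0)
    refine ⟨le_antisymm (hle _) ?_, fun h => ?_⟩
    · rw [hsup]; exact le_iSup₂_of_le (f := fun i (_ : i ≤ 0) => ‖y i‖ₑ) 0 le_rfl le_rfl
    · have h' : supNormUpTo y (-1) = ‖y 0‖ₑ := Eq.trans h hsup
      have hn0 : 0 < ‖y 0‖ := norm_pos_iff.2 h0
      -- Only finitely many past norms reach `‖y 0‖ / 2`. Their maximum, or `‖y 0‖ / 2` if there are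
      -- none, is a bound strictly below `‖y 0‖`.
      obtain ⟨c, hc0, hc, hcy⟩ : ∃ c : ℝ, 0 ≤ c ∧ c < ‖y 0‖ ∧ ∀ i < 0, ‖y i‖ ≤ c := by
        have hfin : ({i | ‖y 0‖ / 2 ≤ ‖y i‖} ∩ Iio 0).Finite :=
          (finite_le_norm hy (half_pos hn0)).inter_of_left _
        by_cases hne : ({i | ‖y 0‖ / 2 ≤ ‖y i‖} ∩ Iio 0).Nonempty
        · obtain ⟨k, hk, hmax⟩ := exists_max_image _ (fun i => ‖y i‖) hfin hne
          refine ⟨‖y k‖, norm_nonneg _, h2 k hk.2, fun i hi => ?_⟩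
          by_cases hi' : ‖y 0‖ / 2 ≤ ‖y i‖
          · exact hmax i ⟨hi', hi⟩
          · exact (not_le.1 hi').le.trans hk.1
        · refine ⟨‖y 0‖ / 2, by positivity, half_lt_self hn0, fun i hi => ?_⟩
          by_contra hcon
          exact hne ⟨i, (not_le.1 hcon).le, hi⟩
      have : supNormUpTo y (-1) ≤ ENNReal.ofReal c := iSup₂_le fun i hi => by
        rw [← ofReal_norm]
        exact ENNReal.ofReal_le_ofReal (hcy i (by omega))
      rw [h', ← ofReal_norm, ENNReal.ofReal_le_ofReal_iff hc0] at this
      linarith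

lemma supNorm_of_firstArgmaxAt {y : ℤ → E} (h : y ∈ firstArgmaxAt 0) :
    (supNorm y).toReal = ‖y 0‖ := by
  have : supNorm y = ‖y 0‖ₑ :=
    le_antisymm (iSup_le fun i => enorm_le_iff_norm_le.2 (h.1 i)) (le_iSup (fun i => ‖y i‖ₑ) 0)
  rw [this, toReal_enorm]

lemma smul_mem_firstArgmaxAt_iff {y : ℤ → E} {c : ℝ} (hc : 0 < c) :
    (fun j => c • y j) ∈ firstArgmaxAt 0 ↔ y ∈ firstArgmaxAt 0 := by
  simp only [firstArgmaxAt, mem_ofPred_eq, norm_smul, Real.norm_of_nonneg hc.le,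
    mul_le_mul_iff_right₀ hc, mul_lt_mul_iff_right₀ hc]

/-! ### The cluster measure -/

lemma measurable_smul_seq : Measurable fun p : ℝ × (ℤ → E) => fun j => p.1 • p.2 j :=
  measurable_pi_lambda _ fun j => measurable_fst.smul ((measurable_pi_apply j).comp measurable_snd)

lemma norm_smul_spectral {ω : Ω'} (h : 1 < ‖Y 0 ω‖) (c : ℝ) :
    (fun j => (c * ‖Y 0 ω‖) • spectral Y ω j) = fun j => c • Y j ω := by
  ext j
  rw [spectral, smul_smul, mul_assoc, mul_inv_cancel₀ (by linarith), mul_one]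

lemma spectral_mem_firstArgmaxAt_iff {ω : Ω'} (h : 1 < ‖Y 0 ω‖) :
    spectral Y ω ∈ firstArgmaxAt 0 ↔ (fun j => Y j ω) ∈ firstArgmaxAt 0 :=
  smul_mem_firstArgmaxAt_iff (inv_pos.2 (by linarith))

lemma ae_infargmax_spectral (h1 : ∀ᵐ ω ∂P', 1 < ‖Y 0 ω‖)
    (h2 : ∀ᵐ ω ∂P', Tendsto (fun j : ℤ => Y j ω) cofinite (𝓝 0)) :
    {ω | infargmax (spectral Y ω) = 0} =ᵐ[P'] {ω | (fun j => Y j ω) ∈ firstArgmaxAt 0} := by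
  filter_upwards [h1, h2] with ω h3 h4
  have h5 : Tendsto (spectral Y ω) cofinite (𝓝 0) := by
    have := h4.const_smul ‖Y 0 ω‖⁻¹
    rwa [smul_zero] at this
  have hpos : 0 < ‖Y 0 ω‖ := by linarith
  have h6 : spectral Y ω 0 ≠ 0 := smul_ne_zero (inv_pos.2 hpos).ne' (norm_pos_iff.1 hpos)
  exact propext ((infargmax_eq_zero_iff h5 h6).trans (spectral_mem_firstArgmaxAt_iff h3))

lemma ae_infargmax (h1 : ∀ᵐ ω ∂P', 1 < ‖Y 0 ω‖)
    (h2 : ∀ᵐ ω ∂P', Tendsto (fun j : ℤ => Y j ω) cofinite (𝓝 0)) :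
    {ω | infargmax (fun j => Y j ω) = 0} =ᵐ[P'] {ω | (fun j => Y j ω) ∈ firstArgmaxAt 0} := by
  filter_upwards [h1, h2] with ω h3 h4
  exact propext (infargmax_eq_zero_iff h4 (norm_pos_iff.1 (by linarith)))

/-- The section at radius `z` of the cluster measure. -/
def clusterSection (P' : Measure Ω') (Y : ℤ → Ω' → E) (T : Set (ℤ → E)) (z : ℝ) : ℝ≥0∞ :=
  P' {ω | (fun j => z • spectral Y ω j) ∈ T ∧ (fun j => Y j ω) ∈ firstArgmaxAt 0}

lemma measurableSet_pathFirstArgmax (hYm : ∀ j, Measurable (Y j)) :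
    MeasurableSet {ω | (fun j => Y j ω) ∈ firstArgmaxAt 0} :=
  (measurable_pi_lambda (fun ω j => Y j ω) hYm) (measurableSet_firstArgmaxAt 0)

lemma clusterMeasure_apply (hYm : ∀ j, Measurable (Y j)) (h1 : ∀ᵐ ω ∂P', 1 < ‖Y 0 ω‖)
    (h2 : ∀ᵐ ω ∂P', Tendsto (fun j : ℤ => Y j ω) cofinite (𝓝 0)) {T : Set (ℤ → E)}
    (hT : MeasurableSet T) :
    clusterMeasure P' Y α T = ∫⁻ z, clusterSection P' Y T z ∂(radial α) := by
  have hs := measurable_spectral hYm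
  have hm : Measurable fun p : ℝ × Ω' => p.1 • spectral Y p.2 :=
    measurable_smul_seq.comp (measurable_fst.prodMk (hs.comp measurable_snd))
  rw [clusterMeasure, Measure.restrict_congr_set (ae_infargmax_spectral h1 h2),
    Measure.map_apply hm hT, Measure.prod_apply (hm hT)]
  refine lintegral_congr fun z => ?_
  have hz : MeasurableSet (Prod.mk z ⁻¹' ((fun p : ℝ × Ω' => p.1 • spectral Y p.2) ⁻¹' T)) :=
    measurable_prodMk_left (hm hT)
  rw [Measure.restrict_apply hz]
  rfl

/-- The polar decomposition evaluated on pairs (radius, spectral path): since `ε * ‖Y 0‖` times the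
spectral path is `ε • Y`, the radial integral over `(ε, ∞)` becomes a probability for the tail
process. -/
lemma setLIntegral_clusterSection (hXm : ∀ j, Measurable (X j)) (hYm : ∀ j, Measurable (Y j))
    (hRV : IsRegularlyVarying P X α) (hY : IsTailProcess P X P' Y) {T : Set (ℤ → E)}
    (hT : MeasurableSet T) {ε : ℝ} (hε : 0 < ε) :
    ∫⁻ z in Ioi ε, clusterSection P' Y T z ∂(radial α) = ENNReal.ofReal (ε ^ (-α)) *
      P' {ω | (fun j => ε • Y j ω) ∈ T ∧ (fun j => Y j ω) ∈ firstArgmaxAt 0} := by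
  have hs := measurable_spectral hYm
  have hone := hY.ae_one_lt hXm hYm hRV
  have hn : Measurable fun ω => ε * ‖Y 0 ω‖ := (hYm 0).norm.const_mul ε
  set A : Set (ℝ × (ℤ → E)) := {p | (fun j => p.1 • p.2 j) ∈ T ∧ p.2 ∈ firstArgmaxAt 0} with hA
  have hAm : MeasurableSet A :=
    (measurable_smul_seq hT).inter (measurable_snd (measurableSet_firstArgmaxAt 0))
  have h := congrArg (fun μ => μ A) (hY.prod_radial_spectral hXm hYm hRV hε)
  beta_reduce at h
  rw [Measure.prod_apply hAm, Measure.smul_apply, Measure.map_apply (hn.prodMk hs) hAm,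
    smul_eq_mul] at h
  calc _ = ∫⁻ z in Ioi ε, (P'.map (spectral Y)) (Prod.mk z ⁻¹' A) ∂(radial α) := by
        refine lintegral_congr fun z => ?_
        rw [Measure.map_apply hs (measurable_prodMk_left hAm)]
        refine measure_congr ?_
        filter_upwards [hone] with ω hω
        exact propext (and_congr_right fun _ => (spectral_mem_firstArgmaxAt_iff hω).symm)
    _ = _ := h
    _ = _ := by
        congr 1
        refine measure_congr ?_
        filter_upwards [hone] with ω hω
        refine propext (and_congr ?_ (spectral_mem_firstArgmaxAt_iff hω))
        show (fun j => (ε * ‖Y 0 ω‖) • spectral Y ω j) ∈ T ↔ _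
        rw [norm_smul_spectral hω]

lemma tendsto_clusterMeasure (hXm : ∀ j, Measurable (X j)) (hYm : ∀ j, Measurable (Y j))
    (hRV : IsRegularlyVarying P X α) (hY : IsTailProcess P X P' Y)
    (h2 : ∀ᵐ ω ∂P', Tendsto (fun j : ℤ => Y j ω) cofinite (𝓝 0)) {T : Set (ℤ → E)}
    (hT : MeasurableSet T) {ε : ℕ → ℝ} (hε : ∀ k, 0 < ε k) (hε' : Antitone ε)
    (hε0 : Tendsto ε atTop (𝓝 0)) :
    Tendsto (fun k => ENNReal.ofReal (ε k ^ (-α)) *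
      P' {ω | (fun j => ε k • Y j ω) ∈ T ∧ (fun j => Y j ω) ∈ firstArgmaxAt 0}) atTop
      (𝓝 (clusterMeasure P' Y α T)) := by
  have hone := hY.ae_one_lt hXm hYm hRV
  have hmono : Monotone fun k => Ioi (ε k) := fun k l hkl => Ioi_subset_Ioi (hε' hkl)
  have hunion : ⋃ k, Ioi (ε k) = Ioi 0 := by
    ext z
    simp only [mem_iUnion, mem_Ioi]
    exact ⟨fun ⟨k, hk⟩ => (hε k).trans hk, fun hz => (hε0.eventually_lt_const hz).exists⟩
  have hrest : (radial α).restrict (Ioi 0) = radial α := by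
    refine Measure.restrict_eq_self_of_ae_mem ?_
    exact (withDensity_absolutelyContinuous _ _).ae_le (ae_restrict_mem measurableSet_Ioi)
  have hlim := tendsto_atTop_iSup
    (f := fun k => ∫⁻ z in Ioi (ε k), clusterSection P' Y T z ∂(radial α))
    fun k l hkl => lintegral_mono_set (hmono hkl)
  rw [← setLIntegral_iUnion_of_directed _ hmono.directed_le, hunion, hrest,
    ← clusterMeasure_apply hYm hone h2 hT] at hlim
  exact hlim.congr fun k => setLIntegral_clusterSection hXm hYm hRV hY hT (hε k)

lemma candidateIndex_eq (h1 : ∀ᵐ ω ∂P', 1 < ‖Y 0 ω‖)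
    (h2 : ∀ᵐ ω ∂P', Tendsto (fun j : ℤ => Y j ω) cofinite (𝓝 0)) :
    candidateIndex P' Y = P' {ω | (fun j => Y j ω) ∈ firstArgmaxAt 0} :=
  measure_congr (ae_infargmax h1 h2)

/-- Almost every path attains its maximum for the first time somewhere. If this had probability zero
of happening at `0`, time change would give probability zero at every index. -/
lemma candidateIndex_pos (hXm : ∀ j, Measurable (X j)) (hYm : ∀ j, Measurable (Y j))
    (hX : IsStationary P X) (hRV : IsRegularlyVarying P X α) (hY : IsTailProcess P X P' Y)
    (h2 : ∀ᵐ ω ∂P', Tendsto (fun j : ℤ => Y j ω) cofinite (𝓝 0)) :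
    0 < candidateIndex P' Y := by
  have hone := hY.ae_one_lt hXm hYm hRV
  rw [candidateIndex_eq hone h2, pos_iff_ne_zero]
  intro h0
  have := (isAnchor_firstArgmaxAt hone h2).measure_eq_zero hXm hYm hX hRV hY (G := univ)
    MeasurableSet.univ (fun _ _ => Iff.rfl) (by simpa using h0)
  simp at this

lemma measurable_normalized (hYm : ∀ j, Measurable (Y j)) :
    Measurable fun ω (j : ℤ) => (supNorm fun i => Y i ω).toReal⁻¹ • Y j ω := by
  have hsup : Measurable fun ω => supNorm fun i => Y i ω :=
    Measurable.iSup fun j => (hYm j).enorm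
  exact measurable_pi_lambda _ fun j => hsup.ennreal_toReal.inv.smul (hYm j)

lemma ae_lawQ_memL1 (hYm : ∀ j, Measurable (Y j)) (hl1 : ∀ᵐ ω ∂P', MemL1 (fun j => Y j ω)) :
    ∀ᵐ q ∂(lawQ P' Y), MemL1 q := by
  rw [lawQ]
  refine (ae_map_iff (measurable_normalized hYm).aemeasurable measurableSet_memL1).2 ?_
  refine ProbabilityTheory.cond_absolutelyContinuous.ae_le ?_
  filter_upwards [hl1] with ω h
  exact h.smul _

lemma ae_clusterMeasure_memL1 (hYm : ∀ j, Measurable (Y j))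
    (hl1 : ∀ᵐ ω ∂P', MemL1 (fun j => Y j ω)) :
    ∀ᵐ x ∂(clusterMeasure P' Y α), MemL1 x := by
  have hm : Measurable fun p : ℝ × Ω' => p.1 • spectral Y p.2 :=
    measurable_smul_seq.comp (measurable_fst.prodMk ((measurable_spectral hYm).comp measurable_snd))
  rw [clusterMeasure]
  refine (ae_map_iff hm.aemeasurable measurableSet_memL1).2 ?_
  have := (Measure.quasiMeasurePreserving_snd (μ := radial α)
    (ν := P'.restrict {ω | infargmax (spectral Y ω) = 0})).ae (ae_restrict_of_ae hl1)
  filter_upwards [this] with p hp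
  exact (hp.smul _).smul _

/-- The cluster measure in terms of the law of `Q`. -/
lemma lintegral_clusterSection_eq (hYm : ∀ j, Measurable (Y j)) (h1 : ∀ᵐ ω ∂P', 1 < ‖Y 0 ω‖)
    (h2 : ∀ᵐ ω ∂P', Tendsto (fun j : ℤ => Y j ω) cofinite (𝓝 0))
    (h0 : 0 < candidateIndex P' Y) (hl1 : ∀ᵐ ω ∂P', MemL1 (fun j => Y j ω))
    {K : (ℤ → E) → ℝ} (hT : MeasurableSet {x | MemL1 x ∧ 1 < K x}) :
    ∫⁻ z, clusterSection P' Y {x | MemL1 x ∧ 1 < K x} z ∂(radial α) = candidateIndex P' Y *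
      ∫⁻ z in Ioi (0 : ℝ), lawQ P' Y {q | 1 < K (z • q)} * ENNReal.ofReal (α * z ^ (-α - 1)) := by
  set T : Set (ℤ → E) := {x | MemL1 x ∧ 1 < K x}
  have hs := measurable_spectral hYm
  have hfin : candidateIndex P' Y ≠ ∞ := measure_ne_top _ _
  have hsec : ∀ z, candidateIndex P' Y * lawQ P' Y {q | 1 < K (z • q)} =
      clusterSection P' Y T z := by
    intro z
    have hm : Measurable fun x : ℤ → E => fun j => z • x j :=
      measurable_smul_seq.comp measurable_prodMk_left
    -- The values of `K` outside `ℓ¹` are arbitrary, so the set on the left need not be measurable;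
    -- it is replaced by its part in `ℓ¹`, where `Q` lives.
    have e1 : lawQ P' Y {q | 1 < K (z • q)} = lawQ P' Y ((fun (q : ℤ → E) j => z • q j) ⁻¹' T) := by
      refine measure_congr ?_
      filter_upwards [ae_lawQ_memL1 hYm hl1] with q hq
      exact propext ⟨fun h => ⟨hq.smul z, h⟩, fun h => h.2⟩
    have hmeas := measurable_normalized hYm (hm hT)
    rw [e1, lawQ, Measure.map_apply (measurable_normalized hYm) (hm hT), ProbabilityTheory.cond,
      Measure.smul_apply, smul_eq_mul, ← mul_assoc]
    change candidateIndex P' Y * (candidateIndex P' Y)⁻¹ * _ = _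
    rw [ENNReal.mul_inv_cancel h0.ne' hfin, one_mul,
      Measure.restrict_congr_set (ae_infargmax h1 h2), Measure.restrict_apply hmeas]
    congr 1
    ext ω
    refine and_congr_left fun hω => ?_
    -- On this event the supremum is `‖Y 0‖`, so the normalised path is the spectral path.
    have e2 := supNorm_of_firstArgmaxAt hω
    show (fun j => z • (supNorm fun i => Y i ω).toReal⁻¹ • Y j ω) ∈ T ↔ _
    rw [e2]
    exact Iff.rfl
  have hmeasg : Measurable (clusterSection P' Y T) := by
    have hA : MeasurableSet {p : ℝ × Ω' | (fun j => p.1 • spectral Y p.2 j) ∈ T ∧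
        (fun j => Y j p.2) ∈ firstArgmaxAt 0} :=
      ((measurable_smul_seq.comp (measurable_fst.prodMk (hs.comp measurable_snd))) hT).inter
        (measurable_snd (measurableSet_pathFirstArgmax hYm))
    exact measurable_measure_prodMk_left hA
  have hdens : Measurable fun z : ℝ => ENNReal.ofReal (α * z ^ (-α - 1)) := by fun_prop
  rw [radial, lintegral_withDensity_eq_lintegral_mul _ hdens hmeasg,
    ← lintegral_const_mul' _ _ hfin]
  refine lintegral_congr fun z => ?_
  rw [← mul_assoc, hsec, mul_comm]
  rfl

/-! ### The limit theorem -/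

lemma smallSum_nonneg (R : ℕ) (c : ℝ) (ω : Ω) : 0 ≤ smallSum X R c ω := by
  rw [smallSum_eq]
  exact Finset.sum_nonneg fun j _ => by split_ifs <;> positivity

/-- Without an exceedance of `b`, the norm of a block comes from the small terms only. -/
lemma tsum_block_le {c b : ℝ} (hc : 0 < c) (R : ℕ) {ω : Ω} (h : ω ∉ blockExceed X R b) :
    ∑' i, ‖block X R c ω i‖ = c⁻¹ * smallSum X R b ω := by
  rw [tsum_eq_sum (s := Finset.Icc (1 : ℤ) R), smallSum_eq, Finset.mul_sum]
  · refine Finset.sum_congr rfl fun i hi => ?_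
    rw [Finset.mem_Icc] at hi
    rw [block, if_pos hi, norm_smul, norm_inv, Real.norm_of_nonneg hc.le, if_pos]
    by_contra hcon
    exact h ⟨i, hi.1, hi.2, not_le.1 hcon⟩
  · intro i hi
    rw [Finset.mem_Icc] at hi
    rw [block, if_neg hi, norm_zero]

lemma measurableSet_block_lt (hXm : ∀ j, Measurable (X j)) {Φ : (ℤ → E) → ℝ} {L : ℝ}
    (hΦ : IsInvariantLipschitz Φ L) (R : ℕ) (c : ℝ) :
    MeasurableSet {ω | 0 < Φ (block X R c ω)} := by
  have hm : Measurable fun ω => block X R c ω := by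
    refine measurable_pi_lambda _ fun j => ?_
    by_cases h : 1 ≤ j ∧ j ≤ (R : ℤ)
    · simp only [block, if_pos h]; exact (hXm j).const_smul _
    · simp only [block, if_neg h]; exact measurable_const
  have := hm (hΦ.measurableSet_lt 0)
  convert this using 1
  ext ω
  exact ⟨fun h => ⟨memL1_block R c ω, h⟩, fun h => h.2⟩

/-- Convergence of the probability that `K > 1` on a block with an exceedance of `ε u_n`. -/
lemma tendsto_block_exceed (hXm : ∀ j, Measurable (X j)) (hYm : ∀ j, Measurable (Y j))
    (hX : IsStationary P X) (hRV : IsRegularlyVarying P X α) (hY : IsTailProcess P X P' Y)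
    (hr : Tendsto r atTop atTop) (hu : Tendsto u atTop atTop) (hDH : ConditionDH P X r u)
    (hAN : ConditionANSJB P X r u) {K : (ℤ → E) → ℝ} (hK : IsLipschitzClusterFunctional K)
    {ε : ℝ} (hε : 0 < ε)
    (hKcont : ∀ᵐ ω ∂P', L1ContinuousAt (exceed K) (fun j => ε • Y j ω)) :
    Tendsto (fun n => P ({ω | 1 < K (block X (r n) (u n) ω)} ∩ blockExceed X (r n) (ε * u n)) /
        (r n * P {ω | u n < ‖X 0 ω‖})) atTop
      (𝓝 (ENNReal.ofReal (ε ^ (-α)) *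
        P' {ω | 1 < K (fun j => ε • Y j ω) ∧ ∀ i < 0, ‖Y i ω‖ ≤ 1})) := by
  obtain ⟨L, hL⟩ := hK.isInvariantLipschitz_sub_one
  have hD := hK.isInvariantLipschitz_exceedDist
  have hl1 := hY.ae_memL1 hXm hYm hX hRV hr hu hDH hAN
  have hb := le_liminf_block hXm hYm hX hRV hY hr hu hDH hAN hL hε
  have he := le_liminf_block hXm hYm hX hRV hY hr hu hDH hAN hD hε
  simp only [sub_pos] at hb
  -- The complementary event is that the distance to `{K > 1}` is positive. It is disjoint from `K >
  -- 1` on blocks, and by continuity `ε • Y` almost surely satisfies one of the two.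
  refine tendsto_of_complement ?_ ?_ (fun n => ?_) hb he
    ((limsup_blockExceed_le hXm hYm hX hRV hY hr hu hε).trans ?_)
  · exact ENNReal.mul_ne_top ENNReal.ofReal_ne_top (measure_ne_top _ _)
  · exact ENNReal.mul_ne_top ENNReal.ofReal_ne_top (measure_ne_top _ _)
  · rw [← ENNReal.add_div]
    refine ENNReal.div_le_div_right ?_ _
    have hm := measurableSet_block_lt hXm hD (r n) (u n)
    rw [← measure_inter_add_sdiff (blockExceed X (r n) (ε * u n)) hm, add_comm]
    refine add_le_add (measure_mono fun ω h => ⟨h.2, h.1⟩) (measure_mono fun ω h => ⟨h.2, ?_⟩)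
    exact fun h' => not_lt_of_exceedDist_pos (memL1_block _ _ _) h' h.1
  · rw [← mul_add]
    refine mul_le_mul_right (le_trans (measure_mono_ae ?_) (measure_union_le _ _)) _
    filter_upwards [hKcont] with ω h1 h3
    by_cases h : 1 < K (fun j => ε • Y j ω)
    · exact Or.inl ⟨h, h3⟩
    · exact Or.inr ⟨exceedDist_pos_of_continuousAt h1 h, h3⟩

theorem tendsto_clusterMeasure_exceed (hXm : ∀ j, Measurable (X j)) (hYm : ∀ j, Measurable (Y j))
    (hX : IsStationary P X) (hRV : IsRegularlyVarying P X α) (hY : IsTailProcess P X P' Y)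
    (hr : Tendsto r atTop atTop) (hu : Tendsto u atTop atTop) (hDH : ConditionDH P X r u)
    (hAN : ConditionANSJB P X r u) {K : (ℤ → E) → ℝ} (hK : IsLipschitzClusterFunctional K)
    (hKcont : ∀ s : ℝ, 0 < s → ∀ᵐ ω ∂P', L1ContinuousAt (exceed K) (fun j => s • Y j ω)) :
    Tendsto (fun n => P {ω | 1 < K (block X (r n) (u n) ω)} / (r n * P {ω | u n < ‖X 0 ω‖})) atTop
      (𝓝 (clusterMeasure P' Y α {x | MemL1 x ∧ 1 < K x})) ∧
    clusterMeasure P' Y α {x | MemL1 x ∧ 1 < K x} < ∞ := by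
  obtain ⟨L, hL⟩ := hK.isInvariantLipschitz_sub_one
  have hone := hY.ae_one_lt hXm hYm hRV
  have hzero := hY.tendsto_zero hXm hYm hRV hr hu hDH
  have hl1 := hY.ae_memL1 hXm hYm hX hRV hr hu hDH hAN
  have hL0 := hL.nonneg
  set T : Set (ℤ → E) := {x | MemL1 x ∧ 1 < K x}
  have hT : MeasurableSet T := by
    simpa only [sub_pos] using hL.measurableSet_lt 0
  set ε : ℕ → ℝ := fun k => 1 / ((k : ℝ) + 1)
  have hε : ∀ k, 0 < ε k := fun k => by positivity
  have hεanti : Antitone ε := fun k l hkl => by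
    simp only [ε]; gcongr
  have hε0 : Tendsto ε atTop (𝓝 0) := tendsto_one_div_add_atTop_nhds_zero_nat
  -- Without exceedances, `K > 1` forces `L` times the normalised small-term sum above `1`. The
  -- denominator `L + 1` also covers `L = 0`.
  have hη : 0 < 1 / (L + 1) := by positivity
  have hV := tendsto_clusterMeasure hXm hYm hRV hY hzero hT hε hεanti hε0
  -- Blocks lead to the first-exceedance anchor, the cluster measure uses the first-maximum anchor;
  -- they agree because `{K > 1}` in `ℓ¹` is shift-invariant.
  have hVeq : ∀ k, P' {ω | 1 < K (fun j => ε k • Y j ω) ∧ ∀ i < 0, ‖Y i ω‖ ≤ 1} =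
      P' {ω | (fun j => ε k • Y j ω) ∈ T ∧ (fun j => Y j ω) ∈ firstArgmaxAt 0} := by
    intro k
    have hGm : MeasurableSet {y : ℤ → E | (fun j => ε k • y j) ∈ T} :=
      (measurable_smul_seq.comp (measurable_prodMk_left (x := ε k))) hT
    have h := (isAnchor_firstExceedAt hone hzero).measure_eq (isAnchor_firstArgmaxAt hone hzero)
      hXm hYm hX hRV hY hGm (fun y l => by
        show MemL1 (fun j => ε k • y (j - l)) ∧ 1 < K (fun j => ε k • y (j - l)) ↔
          MemL1 (fun j => ε k • y j) ∧ 1 < K (fun j => ε k • y j)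
        have e := memL1_shift_iff (x := fun j => ε k • y j) (-l)
        constructor
        · rintro ⟨h1, h2⟩
          have h3 := e.1 h1
          exact ⟨h3, lt_of_lt_of_eq h2 (hK.shift_invariant _ h3 (-l))⟩
        · rintro ⟨h1, h2⟩
          exact ⟨e.2 h1, lt_of_lt_of_eq h2 (hK.shift_invariant _ h1 (-l)).symm⟩)
    refine Eq.trans (measure_congr ?_) h
    filter_upwards [hone, hl1] with ω h1 h2
    exact propext ⟨fun h => ⟨⟨h2.smul _, h.1⟩, h1, h.2⟩, fun h => ⟨h.1.2, h.2.2⟩⟩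
  have hεr : Tendsto ε atTop (𝓝[>] 0) :=
    tendsto_nhdsWithin_iff.2 ⟨hε0, Eventually.of_forall hε⟩
  refine tendsto_of_approx
    (b := fun k n => P ({ω | 1 < K (block X (r n) (u n) ω)} ∩ blockExceed X (r n) (ε k * u n)) /
        (r n * P {ω | u n < ‖X 0 ω‖}))
    (c := fun k n => P {ω | 1 / (L + 1) * u n < smallSum X (r n) (ε k * u n) ω} /
        (r n * P {ω | u n < ‖X 0 ω‖}))
    (fun k => ?_) (fun k n => ?_) (fun k => ?_) (fun k => le_rfl) ((hAN _ hη).comp hεr) hV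
    (fun k => ENNReal.mul_ne_top ENNReal.ofReal_ne_top (measure_ne_top _ _))
  · rw [← hVeq k]
    exact tendsto_block_exceed hXm hYm hX hRV hY hr hu hDH hAN hK (hε k) (hKcont _ (hε k))
  · exact ENNReal.div_le_div_right (measure_mono inter_subset_left) _
  · filter_upwards [hu.eventually_gt_atTop 0] with n hun
    rw [← ENNReal.add_div]
    refine ENNReal.div_le_div_right (le_trans (measure_mono fun ω hω => ?_)
      (measure_union_le _ _)) _
    by_cases hex : ω ∈ blockExceed X (r n) (ε k * u n)
    · exact Or.inl ⟨hω, hex⟩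
    · right
      have h1 := hL.lipschitz _ 0 (memL1_block (X := X) (r n) (u n) ω)
        (by simp [MemL1])
      simp only [Pi.zero_apply, sub_zero, tsum_block_le hun (r n) hex, hK.map_zero] at h1
      have h2 : 1 < K (block X (r n) (u n) ω) := hω
      have h3 := (abs_le.1 h1).2
      have h4 := smallSum_nonneg (X := X) (r n) (ε k * u n) ω
      have h5 : 1 < L * ((u n)⁻¹ * smallSum X (r n) (ε k * u n) ω) := by linarith
      have h6 : 0 ≤ (u n)⁻¹ * smallSum X (r n) (ε k * u n) ω := by positivity
      show 1 / (L + 1) * u n < smallSum X (r n) (ε k * u n) ω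
      have h7 : 1 / (L + 1) < (u n)⁻¹ * smallSum X (r n) (ε k * u n) ω := by
        rw [div_lt_iff₀ (by positivity)]; nlinarith
      rwa [lt_inv_mul_iff₀ hun, mul_comm] at h7

end ClusterLimit

end

theorem mainTheorem6
    {E : Type*} [NormedAddCommGroup E] [NormedSpace ℝ E] [FiniteDimensional ℝ E]
    [MeasurableSpace E] [BorelSpace E]
    {Ω : Type*} [MeasurableSpace Ω] (P : Measure Ω) [IsProbabilityMeasure P]
    (X : ℤ → Ω → E) (hXm : ∀ j, Measurable (X j))
    (hX : ClusterLimit.IsStationary P X)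
    (α : ℝ) (hRV : ClusterLimit.IsRegularlyVarying P X α)
    {Ω' : Type*} [MeasurableSpace Ω'] (P' : Measure Ω') [IsProbabilityMeasure P']
    (Y : ℤ → Ω' → E) (hYm : ∀ j, Measurable (Y j))
    (hY : ClusterLimit.IsTailProcess P X P' Y)
    (r : ℕ → ℕ) (hr : Tendsto r atTop atTop)
    (u : ℕ → ℝ) (hu : Tendsto u atTop atTop)
    (hDH : ClusterLimit.ConditionDH P X r u)
    (hAN : ClusterLimit.ConditionANSJB P X r u)
    (K : (ℤ → E) → ℝ) (hK : ClusterLimit.IsLipschitzClusterFunctional K)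
    (hKcont : ∀ s : ℝ, 0 < s → ∀ᵐ ω ∂P',
      ClusterLimit.L1ContinuousAt (ClusterLimit.exceed K) (fun j => s • Y j ω)) :
    -- the objects in the limit are well defined
    (∀ᵐ ω ∂P', Tendsto (fun j : ℤ => Y j ω) cofinite (𝓝 0)) ∧
    0 < ClusterLimit.candidateIndex P' Y ∧
    (∀ᵐ q ∂(ClusterLimit.lawQ P' Y), ClusterLimit.MemL1 q) ∧
    (∀ᵐ x ∂(ClusterLimit.clusterMeasure P' Y α), ClusterLimit.MemL1 x) ∧
    -- the limit
    Tendsto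
      (fun n : ℕ => P {ω | 1 < K (ClusterLimit.block X (r n) (u n) ω)}
        / ((r n : ℝ≥0∞) * P {ω | u n < ‖X 0 ω‖}))
      atTop (𝓝 (ClusterLimit.clusterMeasure P' Y α {x | 1 < K x})) ∧
    ClusterLimit.clusterMeasure P' Y α {x | 1 < K x}
      = ClusterLimit.candidateIndex P' Y *
        ∫⁻ z in Ioi (0 : ℝ), ClusterLimit.lawQ P' Y {q | 1 < K (z • q)} *
          ENNReal.ofReal (α * z ^ (-α - 1)) ∧
    ClusterLimit.clusterMeasure P' Y α {x | 1 < K x} < ∞ := by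
  have : ProperSpace E := FiniteDimensional.proper_real E
  have : SecondCountableTopology E := secondCountable_of_proper
  have hone := hY.ae_one_lt hXm hYm hRV
  have hzero := hY.tendsto_zero hXm hYm hRV hr hu hDH
  have hl1 := hY.ae_memL1 hXm hYm hX hRV hr hu hDH hAN
  have hpos := ClusterLimit.candidateIndex_pos hXm hYm hX hRV hY hzero
  have hν := ClusterLimit.ae_clusterMeasure_memL1 (α := α) hYm hl1
  obtain ⟨L, hL⟩ := hK.isInvariantLipschitz_sub_one
  have hT : MeasurableSet {x | ClusterLimit.MemL1 x ∧ 1 < K x} := by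
    simpa only [sub_pos] using hL.measurableSet_lt 0
  -- `K` is unconstrained off `ℓ¹`, but the cluster measure does not charge that part.
  have heq : ClusterLimit.clusterMeasure P' Y α {x | 1 < K x} =
      ClusterLimit.clusterMeasure P' Y α {x | ClusterLimit.MemL1 x ∧ 1 < K x} := by
    refine measure_congr ?_
    filter_upwards [hν] with x hx
    exact propext ⟨fun h => ⟨hx, h⟩, fun h => h.2⟩
  obtain ⟨hlim, hfin⟩ := ClusterLimit.tendsto_clusterMeasure_exceed hXm hYm hX hRV hY hr hu hDH
    hAN hK hKcont
  rw [heq]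
  refine ⟨hzero, hpos, ClusterLimit.ae_lawQ_memL1 hYm hl1, hν, hlim, ?_, hfin⟩
  rw [ClusterLimit.clusterMeasure_apply hYm hone hzero hT]
  exact ClusterLimit.lintegral_clusterSection_eq hYm hone hzero hpos hl1 hT
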